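/- For $\tau$ in the upper half-plane $\mathcal H=\{\operatorname{Im}\tau>0\}$ and $\nu\in\mathbb C$ put $q=e^{2\pi i\tau}$, $x=e^{2\pi i\nu}$, $\tau^*=-1/\tau$, and $$L_1(\tau,\nu)=\sum_{n=0}^{\infty}\frac{xq^n}{1-xq^n},\qquad L_2(\tau,\nu)=\sum_{n=0}^{\infty}\frac{(n+1)\,xq^n}{1-xq^n}.$$ Let $\log$ be the principal branch and $\gamma$ Euler's constant. For $d\in(-\pi,0)$ with $\left|\operatorname{Re}\left(e^{id}\nu i/\tau\right)\right|<\operatorname{Re}\left(e^{id}i/\tau\right)$ let $$P(\tau,\nu)=\int_0^{\infty e^{id}}\frac{\sin(\nu t/\tau)}{e^{it/\tau}-1}\left(\cot\frac t2-\frac2t\right)\frac{dt}{t},$$ the path being the half line from $0$ to infinity with argument $d$. For $\tau\in\mathcal H$, the integral converges absolutely, its value does not depend on the choice of such a $d$, and $P(\tau,\cdot)$ is defined in a neighbourhood of $\nu=0$ and complex differentiable at $\nu=0$. Theorem 3.4. For every $\tau\in\mathcal H$ the series $L_1(\tau,\tau)$ and $L_2(\tau,\tau)$ converge absolutely, $$L_1(\tau,\tau)=\frac{\log(-2\pi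 i\tau)}{2\pi i\tau}+\frac14-\frac{\gamma}{2\pi i\tau}-\frac1{2\pi i}\,\frac{\partial P}{\partial\nu}(\tau,0)+\frac1\tau\,L_1(\tau^*,\tau^*),$$ and $$L_2(\tau,\tau)=\frac1{24}+\frac1{4\pi i\tau}-\frac1{24\tau^2}+\frac1{\tau^2}\,L_2(\tau^*,\tau^*).$$ The latter is the transformation law of the Eisenstein series $E_2$ of weight $2$ (normalized to have constant term $1$): $E_2(\tau)=1-24L_2(\tau,\tau)$ and $E_2(-1/\tau)=\tau^2E_2(\tau)+\dfrac{6\tau}{\pi i}$. -/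

import Mathlib

noncomputable section

/-- The `n`-th term `x qⁿ / (1 - x qⁿ)` of the generalized Lambert series `L₁`, where
`q = exp (2πiτ)` and `x = exp (2πiν)`. -/
def lambertTerm₁ (τ ν : ℂ) (n : ℕ) : ℂ :=
  Complex.exp (2 * Real.pi * Complex.I * ν) * Complex.exp (2 * Real.pi * Complex.I * τ) ^ n /
    (1 - Complex.exp (2 * Real.pi * Complex.I * ν) *
      Complex.exp (2 * Real.pi * Complex.I * τ) ^ n)

/-- The `n`-th term `(n + 1) x qⁿ / (1 - x qⁿ)` of the generalized Lambert series `L₂`, where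
`q = exp (2πiτ)` and `x = exp (2πiν)`. -/
def lambertTerm₂ (τ ν : ℂ) (n : ℕ) : ℂ :=
  (n + 1) * lambertTerm₁ τ ν n

/-- The generalized Lambert series `L₁(τ, ν) = ∑_{n ≥ 0} x qⁿ / (1 - x qⁿ)`. -/
def lambertL₁ (τ ν : ℂ) : ℂ := ∑' n : ℕ, lambertTerm₁ τ ν n

/-- The generalized Lambert series `L₂(τ, ν) = ∑_{n ≥ 0} (n + 1) x qⁿ / (1 - x qⁿ)`. -/
def lambertL₂ (τ ν : ℂ) : ℂ := ∑' n : ℕ, lambertTerm₂ τ ν n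

/-- The integrand `sin (ν t / τ) / (exp (i t / τ) - 1) * (cot (t / 2) - 2 / t) / t`. -/
def perturbationIntegrand (τ ν t : ℂ) : ℂ :=
  Complex.sin (ν / τ * t) / (Complex.exp (Complex.I * t / τ) - 1) *
    (Complex.cot (t / 2) - 2 / t) / t

/-- `Pᵈ(τ, ν)`: the integral of `perturbationIntegrand τ ν` along the half line from `0` to
infinity with argument `d`, parametrized by `t = r exp (i d)`, `r > 0`. -/
def rayP (d : ℝ) (τ ν : ℂ) : ℂ :=
  ∫ r in Set.Ioi (0 : ℝ),
    perturbationIntegrand τ ν (r * Complex.exp (Complex.I * d)) * Complex.exp (Complex.I * d)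

/-- The directions `d ∈ (-π, 0)` for which the integral `Pᵈ(τ, ν)` converges absolutely:
`|Re (exp (i d) ν i / τ)| < Re (exp (i d) i / τ)`. -/
def admissibleDirections (τ ν : ℂ) : Set ℝ :=
  {d | d ∈ Set.Ioo (-Real.pi) 0 ∧
    |(Complex.exp (Complex.I * d) * ν * Complex.I / τ).re| <
      (Complex.exp (Complex.I * d) * Complex.I / τ).re}

open Classical in
/-- The perturbation term `P(τ, ν)`: the common value of the integrals `Pᵈ(τ, ν)` over the
admissible directions `d` (and `0` where there is no admissible direction; if `0 < Im τ`, then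
there is one for every `ν` in a neighbourhood of `0`). -/
def perturbationP (τ ν : ℂ) : ℂ :=
  if h : (admissibleDirections τ ν).Nonempty then rayP h.some τ ν else 0

end

/-!
# The transformation law of the Lambert series `L₁` and `L₂`

The law of `L₂` is that of the Eisenstein series `E₂`, because `L₂(τ, τ) = ∑ σ₁(n) qⁿ`.

The law of `L₁` comes from Binet's integral
`Φ(z) = ∫ e^{-zu} h(u) du`, `h(u) = 1 / (eᵘ - 1) - 1 / u + 1 / 2`,
along a ray `u = rω` with `Re ω > 0` and `Re (zω) > 0`. Frullani's integral evaluates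
`Φ(z) - Φ(z + 1)`, so that `Φ(z)` is the sum of an explicit series (`tendsto_sum_binetStep`). Two
consequences replace every deformation of contours.

* The ray does not matter (`binetIntegral_eq_of_ray`). As `P(τ, ν)` is an integral over `s` of sums
  of `Φ` (`rayP_eq_integral_tsum`), its direction of integration does not matter either.
* If `Im z < 0`, the cotangent series gives `Φ(-z) - Φ(z) = -2πi / (e^{2πiz} - 1)`
  (`binetIntegral_neg_sub`). Summed over the multiples of `τ`, this is
  `2πi L₁(τ, τ) = ∑ Φ(-kτ) - ∑ Φ(kτ)`, and likewise for `-1/τ`.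

It remains to compare `∑ Φ(k / x)` with `∑ Φ(kx)` for `x = τ` and `x = -τ`. Summed under the
integral sign, they are the integrals of `f(u) h(xu) x` and of `f(xu) h(u)`, where
`f(u) = 1 / (eᵘ - 1)`. In `f(u) h(xu) - f(xu) h(u)` the products `f(u) f(xu)` cancel, and what is
left is elementary apart from the values at `z = 1` of `Φ` and of its analogue with `h(u) / u`:
Euler's constant and the constant of Stirling's formula. This is Guinand's formula
(`guinand_formula`). The derivative of `P` enters since `τ ∂P/∂ν (τ, 0) = 2 ∑ Φ(k / τ)`
(`hasDerivAt_perturbationP`).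
-/

namespace LambertSeries
open Complex MeasureTheory Set Filter Topology

noncomputable section

/-! ### Bounds for the kernel, and Frullani's integral -/

/-- The odd function `1 / (eᵘ - 1) - 1 / u + 1 / 2 = coth (u / 2) / 2 - 1 / u`. -/
def cothKernel (u : ℂ) : ℂ := (exp u - 1)⁻¹ - u⁻¹ + 1 / 2

lemma exp_re_sub_one_le_norm (u : ℂ) : Real.exp u.re - 1 ≤ ‖exp u - 1‖ := by
  have := norm_sub_norm_le (exp u) 1
  rwa [norm_exp, norm_one] at this

lemma re_le_norm_exp_sub_one (u : ℂ) : u.re ≤ ‖exp u - 1‖ := by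
  have := Real.add_one_le_exp u.re
  linarith [exp_re_sub_one_le_norm u]

lemma exp_sub_one_ne_zero {u : ℂ} (hu : 0 < u.re) : exp u - 1 ≠ 0 :=
  norm_pos_iff.1 (hu.trans_le (re_le_norm_exp_sub_one u))

lemma ne_zero_of_re_pos {u : ℂ} (hu : 0 < u.re) : u ≠ 0 := by
  rintro rfl; simp at hu

/-- The kernel has a simple zero at `0`; the Taylor expansion of `exp` gives the bound for
`‖u‖ ≤ 1`, and for larger `u` its three summands are bounded separately. -/
lemma norm_cothKernel_le {u : ℂ} (hu : 0 < u.re) :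
    ‖cothKernel u‖ ≤ 3 * ‖u‖ ^ 2 / u.re := by
  have hu0 := ne_zero_of_re_pos hu
  have hE := exp_sub_one_ne_zero hu
  have hre := re_le_norm_exp_sub_one u
  have hle : u.re ≤ ‖u‖ := re_le_norm u
  have hpos : 0 < ‖u‖ := hu.trans_le hle
  rcases le_or_gt ‖u‖ 1 with h1 | h1
  · set R := exp u - (1 + u + u ^ 2 / 2) with hR
    have hRb : ‖R‖ ≤ ‖u‖ ^ 3 * (4 / 18) := by
      have := Complex.exp_bound h1 (n := 3) (by norm_num)
      simp [Finset.sum_range_succ, Nat.factorial] at this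
      rw [hR]
      refine this.trans (le_of_eq (by norm_num))
    have key : cothKernel u = (u ^ 3 / 2 + (u - 2) * R) / (2 * (u * (exp u - 1))) := by
      rw [cothKernel, hR]; field_simp; ring
    have hden : 0 < ‖2 * (u * (exp u - 1))‖ := norm_pos_iff.2 (by simp [hu0, hE])
    rw [key, norm_div, div_le_div_iff₀ hden hu]
    have h3 : ‖u ^ 3 / 2 + (u - 2) * R‖ ≤ 2 * ‖u‖ ^ 3 := by
      have h2 : ‖u - 2‖ ≤ 3 := (norm_sub_le _ _).trans (by simp; linarith)
      calc _ ≤ ‖u ^ 3 / 2‖ + ‖u - 2‖ * ‖R‖ := (norm_add_le _ _).trans (by rw [norm_mul])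
        _ ≤ ‖u‖ ^ 3 / 2 + 3 * (‖u‖ ^ 3 * (4 / 18)) := by
          gcongr; simp
        _ ≤ _ := by nlinarith [pow_pos hpos 3]
    calc _ ≤ 2 * ‖u‖ ^ 3 * u.re := by gcongr
      _ ≤ 2 * ‖u‖ ^ 3 * ‖exp u - 1‖ := by gcongr
      _ ≤ 3 * ‖u‖ ^ 2 * (2 * (‖u‖ * ‖exp u - 1‖)) := by
        nlinarith [mul_pos (pow_pos hpos 3) (norm_pos_iff.2 hE)]
      _ = _ := by simp
  · have hA : ‖(exp u - 1)⁻¹‖ ≤ ‖u‖ ^ 2 / u.re := by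
      rw [norm_inv, inv_eq_one_div]
      gcongr
      nlinarith
    have h1le : 1 ≤ ‖u‖ ^ 2 / u.re := by rw [le_div_iff₀ hu]; nlinarith
    have hB : ‖u⁻¹‖ ≤ ‖u‖ ^ 2 / u.re := by
      rw [norm_inv]; exact (inv_le_one_of_one_le₀ h1.le).trans h1le
    calc _ ≤ ‖(exp u - 1)⁻¹‖ + ‖u⁻¹‖ + ‖(1 / 2 : ℂ)‖ :=
          (norm_add_le _ _).trans (by gcongr; exact norm_sub_le _ _)
      _ ≤ ‖u‖ ^ 2 / u.re + ‖u‖ ^ 2 / u.re + ‖u‖ ^ 2 / u.re := by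
        gcongr; norm_num; linarith
      _ = _ := by ring

/-- Along a ray in the right half plane the kernel is at most linear, near `0` as well as near
infinity. -/
lemma norm_cothKernel_ray_le {ω : ℂ} (hω : 0 < ω.re) {r : ℝ} (hr : 0 < r) :
    ‖cothKernel (r * ω)‖ ≤ 3 * ‖ω‖ ^ 2 / ω.re * r := by
  have h : 0 < ((r : ℂ) * ω).re := by simpa using mul_pos hr hω
  refine (norm_cothKernel_le h).trans (le_of_eq ?_)
  simp [abs_of_pos hr]
  field_simp

lemma continuousOn_cothKernel_ray {ω : ℂ} (hω : 0 < ω.re) :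
    ContinuousOn (fun r : ℝ => cothKernel (r * ω)) (Ioi 0) := by
  intro r hr
  have h : 0 < ((r : ℂ) * ω).re := by simpa using mul_pos hr hω
  unfold cothKernel
  refine ContinuousAt.continuousWithinAt ?_
  have h1 : ContinuousAt (fun r : ℝ => exp ((r : ℂ) * ω) - 1) r := by fun_prop
  have h2 : ContinuousAt (fun r : ℝ => (r : ℂ) * ω) r := by fun_prop
  exact ((h1.inv₀ (exp_sub_one_ne_zero h)).sub (h2.inv₀ (ne_zero_of_re_pos h))).add
    continuousAt_const

lemma norm_exp_neg_mul_ofReal (a : ℂ) (r : ℝ) : ‖exp (-(a * r))‖ = Real.exp (-(a.re * r)) := by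
  simp [norm_exp]

lemma integrableOn_exp_neg_mul {c : ℝ} (hc : 0 < c) :
    IntegrableOn (fun r : ℝ => Real.exp (-(c * r))) (Ioi 0) := by
  simpa using integrableOn_exp_mul_Ioi (a := -c) (by linarith) 0

lemma integrableOn_mul_exp_neg_mul {c : ℝ} (hc : 0 < c) :
    IntegrableOn (fun r : ℝ => r * Real.exp (-(c * r))) (Ioi 0) := by
  simpa using integrableOn_rpow_mul_exp_neg_mul_rpow (p := 1) (s := 1) (by norm_num)
    (by norm_num) hc

lemma integral_cexp_neg_mul {a : ℂ} (ha : 0 < a.re) :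
    ∫ r in Ioi (0 : ℝ), exp (-(a * r)) = 1 / a := by
  have := integral_exp_mul_complex_Ioi (a := -a) (by simpa) 0
  simpa using this

lemma integrableOn_cexp_neg_mul {a : ℂ} (ha : 0 < a.re) :
    IntegrableOn (fun r : ℝ => exp (-(a * r))) (Ioi 0) := by
  simpa using integrableOn_exp_mul_complex_Ioi (a := -a) (by simpa) 0

/-- Frullani's integrand as an integral of exponentials over the segment from `a` to `b`. -/
lemma integral_exp_segment (a b : ℂ) {r : ℝ} (hr : r ≠ 0) :
    ∫ s in (0 : ℝ)..1, (b - a) * exp (-((a + s * (b - a)) * r)) =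
      (exp (-(a * r)) - exp (-(b * r))) / r := by
  have hr' : (r : ℂ) ≠ 0 := by exact_mod_cast hr
  have hd : ∀ s ∈ uIcc (0 : ℝ) 1, HasDerivAt
      (fun s : ℝ => -exp (-((a + s * (b - a)) * r)) / r)
      ((b - a) * exp (-((a + s * (b - a)) * r))) s := by
    intro s _
    have h1 : HasDerivAt (fun s : ℝ => -((a + (s : ℂ) * (b - a)) * r)) (-((1 * (b - a)) * r)) s :=
      ((((hasDerivAt_id s).ofReal_comp).mul_const (b - a)).const_add a |>.mul_const (r : ℂ)).neg
    convert! (h1.cexp.neg.div_const (r : ℂ)) using 1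
    field_simp
  rw [intervalIntegral.integral_eq_sub_of_hasDerivAt hd
    (Continuous.intervalIntegrable (by fun_prop) _ _)]
  simp
  ring

lemma re_segment_ge {a b : ℂ} {s : ℝ} (hs : s ∈ Icc (0 : ℝ) 1) :
    min a.re b.re ≤ (a + s * (b - a)).re := by
  have h : (a + s * (b - a)).re = (1 - s) * a.re + s * b.re := by simp; ring
  rw [h]
  nlinarith [hs.1, hs.2, min_le_left a.re b.re, min_le_right a.re b.re]

lemma integrable_prod_exp_segment {a b : ℂ} (ha : 0 < a.re) (hb : 0 < b.re) :
    Integrable (fun p : ℝ × ℝ => (b - a) * exp (-((a + p.2 * (b - a)) * p.1)))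
      ((volume.restrict (Ioi 0)).prod (volume.restrict (Ioc 0 1))) := by
  have hc : 0 < min a.re b.re := lt_min ha hb
  have hbd : Integrable (fun p : ℝ × ℝ => ‖b - a‖ * Real.exp (-(min a.re b.re * p.1)))
      ((volume.restrict (Ioi 0)).prod (volume.restrict (Ioc 0 1))) := by
    have h1 : Integrable (fun _ : ℝ => (1 : ℝ)) (volume.restrict (Ioc (0 : ℝ) 1)) := by simp
    simpa using (((integrableOn_exp_neg_mul hc).mul_prod h1).const_mul ‖b - a‖)
  refine hbd.mono' (Continuous.aestronglyMeasurable (by fun_prop)) ?_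
  rw [Measure.prod_restrict]
  filter_upwards [ae_restrict_mem (measurableSet_Ioi.prod measurableSet_Ioc)] with p hp
  rw [norm_mul, norm_exp_neg_mul_ofReal]
  have := re_segment_ge (a := a) (b := b) (s := p.2) ⟨hp.2.1.le, hp.2.2⟩
  have hp1 : 0 < p.1 := hp.1
  gcongr

lemma integrableOn_frullani {a b : ℂ} (ha : 0 < a.re) (hb : 0 < b.re) :
    IntegrableOn (fun r : ℝ => (exp (-(a * r)) - exp (-(b * r))) / r) (Ioi 0) := by
  refine ((integrable_prod_exp_segment ha hb).integral_prod_left).congr ?_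
  filter_upwards [ae_restrict_mem measurableSet_Ioi] with r hr
  rw [← integral_exp_segment a b (ne_of_gt hr), intervalIntegral.integral_of_le zero_le_one]

/-- Frullani's integral with complex parameters in the right half plane. -/
lemma integral_frullani {a b : ℂ} (ha : 0 < a.re) (hb : 0 < b.re) :
    ∫ r in Ioi (0 : ℝ), (exp (-(a * r)) - exp (-(b * r))) / r = log b - log a := by
  have h1 : ∫ r in Ioi (0 : ℝ), (exp (-(a * r)) - exp (-(b * r))) / r =
      ∫ r in Ioi (0 : ℝ), ∫ s in Ioc (0 : ℝ) 1, (b - a) * exp (-((a + s * (b - a)) * r)) := by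
    refine setIntegral_congr_fun measurableSet_Ioi fun r hr => ?_
    rw [← integral_exp_segment a b (ne_of_gt hr), intervalIntegral.integral_of_le zero_le_one]
  have hpos : ∀ s ∈ Icc (0 : ℝ) 1, 0 < (a + s * (b - a)).re := fun s hs =>
    (lt_min ha hb).trans_le (re_segment_ge hs)
  rw [h1, integral_integral_swap (integrable_prod_exp_segment ha hb)]
  have h2 : ∫ s in Ioc (0 : ℝ) 1, ∫ r in Ioi (0 : ℝ),
      (b - a) * exp (-((a + s * (b - a)) * r)) =
      ∫ s in (0 : ℝ)..1, (b - a) / (a + s * (b - a)) := by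
    rw [intervalIntegral.integral_of_le zero_le_one]
    refine setIntegral_congr_fun measurableSet_Ioc fun s hs => ?_
    rw [integral_const_mul, integral_cexp_neg_mul (hpos s ⟨hs.1.le, hs.2⟩)]
    ring
  have hd : ∀ s ∈ uIcc (0 : ℝ) 1, HasDerivAt (fun s : ℝ => log (a + s * (b - a)))
      ((b - a) / (a + s * (b - a))) s := by
    intro s hs
    rw [uIcc_of_le zero_le_one] at hs
    have h3 : HasDerivAt (fun s : ℝ => a + (s : ℂ) * (b - a)) (1 * (b - a)) s :=
      (((hasDerivAt_id s).ofReal_comp).mul_const (b - a)).const_add a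
    simpa using h3.clog_real (Or.inl (hpos s hs))
  rw [h2, intervalIntegral.integral_eq_sub_of_hasDerivAt hd]
  · simp
  · refine ContinuousOn.intervalIntegrable ?_
    rw [uIcc_of_le zero_le_one]
    refine ContinuousOn.div (by fun_prop) (by fun_prop) fun s hs => ?_
    exact ne_zero_of_re_pos (hpos s hs)

/-! ### Binet's integral, its series and its reflection formula -/

/-- Binet's integral `∫ e^{-zu} (1 / (eᵘ - 1) - 1 / u + 1 / 2) du` along the ray `u = r ω`,
`r > 0`. It equals `log z - 1 / (2 z) - ψ(z)` with `ψ` the digamma function, if `Re ω > 0` and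
`Re (z ω) > 0`. -/
def binetIntegral (ω z : ℂ) : ℂ :=
  ∫ r in Ioi (0 : ℝ), exp (-(z * ω * r)) * cothKernel (r * ω) * ω

/-- The value of `binetIntegral ω z - binetIntegral ω (z + 1)`, for every admissible ray `ω`. -/
def binetStep (z : ℂ) : ℂ := (1 / z + 1 / (z + 1)) / 2 - (log (z + 1) - log z)

lemma integrableOn_exp_mul_cothKernel {ω a : ℂ} (hω : 0 < ω.re) (ha : 0 < a.re) :
    IntegrableOn (fun r : ℝ => exp (-(a * r)) * cothKernel (r * ω)) (Ioi 0) := by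
  refine ((integrableOn_mul_exp_neg_mul ha).const_mul (3 * ‖ω‖ ^ 2 / ω.re)).mono' ?_ ?_
  · exact ((Continuous.continuousOn (by fun_prop)).mul
      (continuousOn_cothKernel_ray hω)).aestronglyMeasurable measurableSet_Ioi
  · filter_upwards [ae_restrict_mem measurableSet_Ioi] with r hr
    rw [norm_mul, norm_exp_neg_mul_ofReal]
    calc _ ≤ Real.exp (-(a.re * r)) * (3 * ‖ω‖ ^ 2 / ω.re * r) := by
          gcongr; exact norm_cothKernel_ray_le hω hr
      _ = _ := by ring

lemma integrableOn_binet {ω z : ℂ} (hω : 0 < ω.re) (hz : 0 < (z * ω).re) :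
    IntegrableOn (fun r : ℝ => exp (-(z * ω * r)) * cothKernel (r * ω) * ω) (Ioi 0) :=
  (integrableOn_exp_mul_cothKernel hω hz).mul_const ω

lemma re_add_natCast_mul_pos {ω z : ℂ} (hω : 0 < ω.re) (hz : 0 < (z * ω).re) (n : ℕ) :
    0 < ((z + n) * ω).re := by
  have h : ((z + n) * ω).re = (z * ω).re + n * ω.re := by simp; ring
  rw [h]; positivity

lemma re_add_one_mul_pos {ω z : ℂ} (hω : 0 < ω.re) (hz : 0 < (z * ω).re) :
    0 < ((z + 1) * ω).re := by
  simpa using re_add_natCast_mul_pos hω hz 1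

lemma log_mul_of_re_pos {ω z : ℂ} (hω : 0 < ω.re) (hz : 0 < (z * ω).re) :
    log (z * ω) = log z + log ω := by
  have hω0 := ne_zero_of_re_pos hω
  have h1 := abs_lt.1 (abs_arg_lt_pi_div_two_iff.2 (Or.inl hω))
  have h2 := abs_lt.1 (abs_arg_lt_pi_div_two_iff.2 (Or.inl hz))
  have hpi : arg ω ≠ Real.pi := by linarith [Real.pi_pos]
  have h3 : log (z * ω * ω⁻¹) = log (z * ω) + log ω⁻¹ := by
    refine (Complex.log_mul_eq_add_log_iff (ne_zero_of_re_pos hz) (inv_ne_zero hω0)).2 ?_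
    rw [arg_inv, if_neg hpi]
    constructor <;> linarith
  rw [mul_assoc, mul_inv_cancel₀ hω0, mul_one, log_inv _ hpi] at h3
  rw [h3]; ring

/-- The factor `1 - e^{-u}` cancels the denominator `eᵘ - 1`, so that what is left is a combination
of exponentials and of Frullani's integrand. -/
lemma cothKernel_mul_one_sub_exp {u : ℂ} (hu : 0 < u.re) :
    (1 - exp (-u)) * cothKernel u = 1 / 2 + exp (-u) / 2 - (1 - exp (-u)) / u := by
  have hu0 := ne_zero_of_re_pos hu
  have hE := exp_sub_one_ne_zero hu
  have he := exp_ne_zero u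
  rw [cothKernel, exp_neg]
  field_simp
  ring

lemma binetIntegral_sub_add_one {ω z : ℂ} (hω : 0 < ω.re) (hz : 0 < (z * ω).re) :
    binetIntegral ω z - binetIntegral ω (z + 1) = binetStep z := by
  have hz1 := re_add_one_mul_pos hω hz
  have hω0 := ne_zero_of_re_pos hω
  have hz0 : z ≠ 0 := left_ne_zero_of_mul (ne_zero_of_re_pos hz)
  have hz10 : z + 1 ≠ 0 := left_ne_zero_of_mul (ne_zero_of_re_pos hz1)
  rw [binetIntegral, binetIntegral, ← integral_sub (integrableOn_binet hω hz)
    (integrableOn_binet hω hz1)]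
  have h1 : ∫ r in Ioi (0 : ℝ), (exp (-(z * ω * r)) * cothKernel (r * ω) * ω -
      exp (-((z + 1) * ω * r)) * cothKernel (r * ω) * ω) =
      ∫ r in Ioi (0 : ℝ), (ω / 2 * exp (-(z * ω * r)) + ω / 2 * exp (-((z + 1) * ω * r)) -
        (exp (-(z * ω * r)) - exp (-((z + 1) * ω * r))) / r) := by
    refine setIntegral_congr_fun measurableSet_Ioi fun r hr => ?_
    have hr0 : (r : ℂ) ≠ 0 := by exact_mod_cast (ne_of_gt hr)
    have hu : 0 < ((r : ℂ) * ω).re := by simpa using mul_pos hr hω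
    have h2 : exp (-((z + 1) * ω * r)) = exp (-(z * ω * r)) * exp (-(r * ω)) := by
      rw [← exp_add]; ring_nf
    have h3 := cothKernel_mul_one_sub_exp hu
    rw [h2]
    calc _ = exp (-(z * ω * r)) * ω * ((1 - exp (-(r * ω))) * cothKernel (r * ω)) := by ring
      _ = _ := by rw [h3]; field_simp
  rw [h1, integral_sub, integral_add, integral_const_mul, integral_const_mul,
    integral_cexp_neg_mul hz, integral_cexp_neg_mul hz1, integral_frullani hz hz1,
    log_mul_of_re_pos hω hz, log_mul_of_re_pos hω hz1, binetStep]
  · field_simp; ring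
  · exact (integrableOn_cexp_neg_mul hz).const_mul _
  · exact (integrableOn_cexp_neg_mul hz1).const_mul _
  · exact ((integrableOn_cexp_neg_mul hz).const_mul _).add
      ((integrableOn_cexp_neg_mul hz1).const_mul _)
  · exact integrableOn_frullani hz hz1

lemma tendsto_integral_exp_add_natCast {ω z : ℂ} {F : ℝ → ℂ} (hω : 0 < ω.re)
    (hF : IntegrableOn (fun r : ℝ => exp (-(z * ω * r)) * F r) (Ioi 0)) :
    Tendsto (fun n : ℕ => ∫ r in Ioi (0 : ℝ), exp (-((z + n) * ω * r)) * F r)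
      atTop (𝓝 0) := by
  have hrw : ∀ (n : ℕ) (r : ℝ), exp (-((z + n) * ω * r)) * F r =
      exp (-(ω * r)) ^ n * (exp (-(z * ω * r)) * F r) := by
    intro n r
    rw [← mul_assoc, ← exp_nat_mul, ← exp_add]
    ring_nf
  simp_rw [hrw]
  have hlt : ∀ r ∈ Ioi (0 : ℝ), ‖exp (-(ω * r))‖ < 1 := by
    intro r hr
    rw [norm_exp_neg_mul_ofReal, Real.exp_lt_one_iff]
    have : 0 < ω.re * r := mul_pos hω hr
    linarith
  have h := tendsto_integral_of_dominated_convergence (μ := volume.restrict (Ioi (0 : ℝ)))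
    (F := fun (n : ℕ) (r : ℝ) => exp (-(ω * r)) ^ n * (exp (-(z * ω * r)) * F r))
    (f := fun _ => 0) (fun r => ‖exp (-(z * ω * r)) * F r‖) ?_ hF.norm ?_ ?_
  · simpa using h
  · exact fun n => (Continuous.aestronglyMeasurable (by fun_prop)).mul hF.aestronglyMeasurable
  · intro n
    filter_upwards [ae_restrict_mem measurableSet_Ioi] with r hr
    rw [norm_mul, norm_pow]
    exact mul_le_of_le_one_left (norm_nonneg _) (pow_le_one₀ (norm_nonneg _) (hlt r hr).le)
  · filter_upwards [ae_restrict_mem measurableSet_Ioi] with r hr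
    simpa using (tendsto_pow_atTop_nhds_zero_of_norm_lt_one (hlt r hr)).mul_const _

/-- Binet's integral as a series; the right-hand side does not involve the ray. -/
lemma tendsto_sum_binetStep {ω z : ℂ} (hω : 0 < ω.re) (hz : 0 < (z * ω).re) :
    Tendsto (fun N : ℕ => ∑ n ∈ Finset.range N, binetStep (z + n)) atTop
      (𝓝 (binetIntegral ω z)) := by
  have h1 : ∀ N : ℕ, ∑ n ∈ Finset.range N, binetStep (z + n) =
      binetIntegral ω z - binetIntegral ω (z + N) := by
    intro N
    induction N with
    | zero => simp
    | succ N ih =>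
      rw [Finset.sum_range_succ, ih,
        ← binetIntegral_sub_add_one hω (re_add_natCast_mul_pos hω hz N)]
      push_cast
      rw [add_assoc z]
      ring
  simp_rw [h1]
  have h2 : Tendsto (fun N : ℕ => binetIntegral ω (z + N)) atTop (𝓝 0) := by
    have := tendsto_integral_exp_add_natCast (z := z) (F := fun r => cothKernel (r * ω) * ω) hω
      (by simpa only [mul_assoc] using integrableOn_binet hω hz)
    simpa only [binetIntegral, mul_assoc] using this
  simpa using tendsto_const_nhds.sub h2

/-- Binet's integral does not depend on the ray. -/
lemma binetIntegral_eq_of_ray {ω ω' z : ℂ} (hω : 0 < ω.re) (hz : 0 < (z * ω).re)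
    (hω' : 0 < ω'.re) (hz' : 0 < (z * ω').re) : binetIntegral ω z = binetIntegral ω' z :=
  tendsto_nhds_unique (tendsto_sum_binetStep hω hz) (tendsto_sum_binetStep hω' hz')

lemma tendsto_log_natCast_add_sub_log (z : ℂ) :
    Tendsto (fun N : ℕ => log (z + N) - log (N : ℂ)) atTop (𝓝 0) := by
  have h1 : Tendsto (fun N : ℕ => log (1 + z / N)) atTop (𝓝 0) := by
    have h2 : Tendsto (fun N : ℕ => 1 + z / (N : ℂ)) atTop (𝓝 (1 + 0)) :=
      tendsto_const_nhds.add (tendsto_const_div_atTop_nhds_zero_nat z)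
    rw [add_zero] at h2
    have h3 := h2.clog (by simp)
    rwa [log_one] at h3
  refine h1.congr' ?_
  have hev : ∀ᶠ N : ℕ in atTop, ‖z‖ < N :=
    (tendsto_natCast_atTop_atTop (R := ℝ)).eventually_gt_atTop ‖z‖
  filter_upwards [eventually_gt_atTop 0, hev] with N hN hzN
  have hN' : (N : ℂ) ≠ 0 := by exact_mod_cast hN.ne'
  have hne : 1 + z / N ≠ 0 := by
    intro h
    have : z = -N := by field_simp at h; linear_combination h
    rw [this] at hzN
    simp at hzN
  have : z + N = ((N : ℝ) : ℂ) * (1 + z / N) := by push_cast; field_simp; ring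
  rw [this, log_ofReal_mul (by exact_mod_cast hN) hne]
  have h4 : log (N : ℂ) = (Real.log N : ℂ) := by
    rw [ofReal_log (by positivity)]; simp
  rw [h4]; ring

lemma log_neg_of_im_neg {z : ℂ} (hz : z.im < 0) : log (-z) = log z + Real.pi * I := by
  simp [log, arg_neg_eq_arg_add_pi_of_im_neg hz]
  ring

lemma pi_mul_cot_of_im_neg {z : ℂ} (hz : z.im < 0) :
    Real.pi * I - Real.pi * cot (Real.pi * z) = -(2 * Real.pi * I) /
      (exp (2 * Real.pi * I * z) - 1) := by
  rw [cot_pi_eq_exp_ratio]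
  have h : exp (2 * Real.pi * I * z) - 1 ≠ 0 := by
    apply exp_sub_one_ne_zero
    simp
    nlinarith [Real.pi_pos, mul_pos Real.pi_pos (neg_pos.2 hz)]
  generalize exp (2 * Real.pi * I * z) = E at h ⊢
  have h' : 1 - E ≠ 0 := by rw [← neg_sub]; exact neg_ne_zero.2 h
  rw [show (E + 1) / (I * (1 - E)) = I * (E + 1) / (E - 1) by
    rw [div_eq_div_iff (mul_ne_zero I_ne_zero h') h]
    linear_combination (E + 1) * (E - 1) * I_sq]
  field_simp
  ring

lemma sum_binetStep (z : ℂ) (N : ℕ) :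
    ∑ n ∈ Finset.range N, binetStep (z + n) =
      ∑ n ∈ Finset.range N, (1 / (z + n) + 1 / (z + n + 1)) / 2 - (log (z + N) - log z) := by
  induction N with
  | zero => simp
  | succ N ih =>
    rw [Finset.sum_range_succ, Finset.sum_range_succ, ih, binetStep]
    push_cast
    rw [add_assoc z]
    ring

/-- The reflection formula. In terms of `ψ` it is `ψ(1 - z) - ψ(z) = π cot (πz)`. As the kernel is
odd, its left-hand side is the change of Binet's integral under a rotation of the ray across the
poles `2πim`, and its right-hand side the sum `-2πi ∑ e^{-2πimz}` of their residues. -/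
lemma binetIntegral_neg_sub {ω ω' z : ℂ} (hω : 0 < ω.re) (hω' : 0 < ω'.re)
    (hz : 0 < (z * ω).re) (hz' : 0 < (-z * ω').re) (him : z.im < 0) :
    binetIntegral ω' (-z) - binetIntegral ω z =
      -(2 * Real.pi * I) / (exp (2 * Real.pi * I * z) - 1) := by
  rw [← pi_mul_cot_of_im_neg him]
  refine tendsto_nhds_unique ((tendsto_sum_binetStep hω' hz').sub (tendsto_sum_binetStep hω hz)) ?_
  have hzi : z ∈ integerComplement := by
    rintro ⟨n, hn⟩
    rw [← hn] at him
    simp at him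
  have hcot := tendsto_logDeriv_euler_cot_sub hzi
  have hcot' := hcot.comp (tendsto_sub_atTop_nat 1)
  -- The rational parts of the two series pair up to partial sums of the cotangent series.
  have hrat : ∀ N : ℕ, 0 < N → ∑ n ∈ Finset.range N, (1 / (-z + n) + 1 / (-z + n + 1)) / 2 -
      ∑ n ∈ Finset.range N, (1 / (z + n) + 1 / (z + n + 1)) / 2 =
      -(1 / z + (∑ j ∈ Finset.range N, cotTerm z j +
        ∑ j ∈ Finset.range (N - 1), cotTerm z j) / 2) := by
    intro N hN
    obtain ⟨M, rfl⟩ : ∃ M, N = M + 1 := ⟨N - 1, by omega⟩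
    clear hN
    simp only [Nat.add_sub_cancel]
    induction M with
    | zero =>
      simp [cotTerm]
      rw [show (-z + 1)⁻¹ = -(z - 1)⁻¹ by rw [← inv_neg]; ring_nf]
      ring
    | succ M ih =>
      rw [Finset.sum_range_succ, Finset.sum_range_succ _ (M + 1), add_sub_add_comm, ih,
        Finset.sum_range_succ _ (M + 1), Finset.sum_range_succ _ M]
      simp only [cotTerm]
      push_cast
      rw [show -z + ((M : ℂ) + 1) = -(z - (M + 1)) by ring,
        show -(z - ((M : ℂ) + 1)) + 1 = -(z - (M + 1 + 1)) by ring,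
        show z + ((M : ℂ) + 1) + 1 = z + (M + 1 + 1) by ring]
      simp only [one_div, inv_neg]
      ring
  have hlog := (tendsto_log_natCast_add_sub_log z).sub (tendsto_log_natCast_add_sub_log (-z))
  have hlim := (((tendsto_const_nhds (x := 1 / z)).add ((hcot.add hcot').div_const 2)).neg.add
    hlog).add (tendsto_const_nhds (x := Real.pi * I))
  have heq : -(1 / z + (Real.pi * cot (Real.pi * z) - 1 / z +
      (Real.pi * cot (Real.pi * z) - 1 / z)) / 2) + (0 - 0) + Real.pi * I =
      Real.pi * I - Real.pi * cot (Real.pi * z) := by ring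
  rw [heq] at hlim
  refine hlim.congr' ?_
  filter_upwards [eventually_gt_atTop 0] with N hN
  rw [sum_binetStep, sum_binetStep, log_neg_of_im_neg him]
  simp only [Function.comp]
  rw [← hrat N hN]
  ring

/-! ### Sums of Binet integrals over arithmetic progressions -/

lemma mul_exp_div_exp_sub_one_le {b c r : ℝ} (hc : 0 < c) (hr : 0 < r) :
    r * Real.exp (b * r) / (Real.exp (c * r) - 1) ≤
      c⁻¹ * Real.exp (-((c - b) * r)) + r * Real.exp (-((c - b) * r)) := by
  have hcr : 0 < c * r := mul_pos hc hr
  have h1 : c * r + 1 ≤ Real.exp (c * r) := Real.add_one_le_exp _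
  have h2 : Real.exp (b * r) = Real.exp (-((c - b) * r)) * Real.exp (c * r) := by
    rw [← Real.exp_add]; ring_nf
  rw [div_le_iff₀ (by linarith), h2, ← add_mul, mul_comm _ (Real.exp (-((c - b) * r))), mul_assoc,
    mul_left_comm]
  refine mul_le_mul_of_nonneg_left ?_ (Real.exp_pos _).le
  have h3 : (c⁻¹ + r) * (Real.exp (c * r) - 1) - r * Real.exp (c * r) =
      c⁻¹ * (Real.exp (c * r) - 1 - c * r) := by field_simp; ring
  have h4 : 0 ≤ c⁻¹ * (Real.exp (c * r) - 1 - c * r) := mul_nonneg (by positivity) (by linarith)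
  linarith

lemma integrableOn_mul_exp_div_exp_sub_one {b c : ℝ} (hc : 0 < c) (hb : b < c) :
    IntegrableOn (fun r : ℝ => r * Real.exp (b * r) / (Real.exp (c * r) - 1)) (Ioi 0) := by
  have h1 : IntegrableOn (fun r : ℝ => c⁻¹ * Real.exp (-((c - b) * r)) +
      r * Real.exp (-((c - b) * r))) (Ioi 0) :=
    ((integrableOn_exp_neg_mul (sub_pos.2 hb)).const_mul _).add
      (integrableOn_mul_exp_neg_mul (sub_pos.2 hb))
  refine h1.mono' (Measurable.aestronglyMeasurable (by fun_prop)) ?_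
  filter_upwards [ae_restrict_mem measurableSet_Ioi] with r hr
  have hr' : 0 < r := hr
  have h2 : 0 ≤ Real.exp (c * r) - 1 := by
    have := Real.add_one_le_exp (c * r)
    have := mul_pos hc hr'
    linarith
  rw [Real.norm_of_nonneg (by positivity)]
  exact mul_exp_div_exp_sub_one_le hc hr

lemma norm_exp_mul_ofReal (a : ℂ) (r : ℝ) : ‖exp (a * r)‖ = Real.exp (a.re * r) := by
  simp [norm_exp]

/-- The pole of the Bose factor `e^{ar} / (e^{cr} - 1)` at `r = 0` is cancelled by the zero of the
kernel. -/
lemma norm_boseKernel_le {ω a c : ℂ} (hω : 0 < ω.re) (hc : 0 < c.re) {r : ℝ} (hr : 0 < r) :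
    ‖exp (a * r) / (exp (c * r) - 1) * cothKernel (r * ω)‖ ≤
      3 * ‖ω‖ ^ 2 / ω.re * (r * Real.exp (a.re * r) / (Real.exp (c.re * r) - 1)) := by
  have h1 : 0 < Real.exp (c.re * r) - 1 := by
    have := Real.add_one_le_exp (c.re * r)
    have := mul_pos hc hr
    linarith
  have h2 : Real.exp (c.re * r) - 1 ≤ ‖exp (c * r) - 1‖ := by
    simpa using exp_re_sub_one_le_norm (c * r)
  rw [norm_mul, norm_div, norm_exp_mul_ofReal]
  calc _ ≤ Real.exp (a.re * r) / (Real.exp (c.re * r) - 1) * (3 * ‖ω‖ ^ 2 / ω.re * r) := by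
        gcongr; exact norm_cothKernel_ray_le hω hr
    _ = _ := by ring

lemma continuousOn_boseKernel {ω c : ℂ} (hω : 0 < ω.re) (hc : 0 < c.re) {g : ℝ → ℂ}
    (hg : ContinuousOn g (Ioi 0)) :
    ContinuousOn (fun r : ℝ => g r / (exp (c * r) - 1) * cothKernel (r * ω)) (Ioi 0) := by
  refine (hg.div (by fun_prop) fun r hr => ?_).mul (continuousOn_cothKernel_ray hω)
  exact exp_sub_one_ne_zero (by simpa using mul_pos hc hr)

lemma integrableOn_boseKernel {ω a c : ℂ} (hω : 0 < ω.re) (hc : 0 < c.re) (ha : a.re < c.re) :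
    IntegrableOn (fun r : ℝ => exp (a * r) / (exp (c * r) - 1) * cothKernel (r * ω)) (Ioi 0) := by
  refine ((integrableOn_mul_exp_div_exp_sub_one hc ha).const_mul
    (3 * ‖ω‖ ^ 2 / ω.re)).mono' ?_ ?_
  · exact (continuousOn_boseKernel hω hc (Continuous.continuousOn
      (by fun_prop))).aestronglyMeasurable measurableSet_Ioi
  · filter_upwards [ae_restrict_mem measurableSet_Ioi] with r hr
    exact norm_boseKernel_le hω hc hr

lemma hasSum_exp_neg_succ {E : ℂ} {a c : ℂ} {r : ℝ} (hc : 0 < c.re) (hr : 0 < r) :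
    HasSum (fun k : ℕ => exp (-(((k + 1) * c - a) * r)) * E)
      (exp (a * r) / (exp (c * r) - 1) * E) := by
  have hlt : ‖exp (-(c * r))‖ < 1 := by
    rw [norm_exp_neg_mul_ofReal, Real.exp_lt_one_iff]
    have := mul_pos hc hr
    linarith
  have hne : exp (c * r) - 1 ≠ 0 := exp_sub_one_ne_zero (by simpa using mul_pos hc hr)
  have h1 := (hasSum_geometric_of_norm_lt_one hlt).mul_left (exp (a * r) * exp (-(c * r)) * E)
  convert! h1 using 1
  · ext k
    rw [← exp_nat_mul, mul_right_comm, ← exp_add, ← exp_add]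
    ring_nf
  · rw [exp_neg]
    have := exp_ne_zero (c * r)
    have h2 : 1 - (exp (c * r))⁻¹ ≠ 0 := by
      intro h; apply hne; field_simp at h; simpa using h
    field_simp

/-- Summing Binet's integral over an arithmetic progression replaces the exponential by a
geometric series. -/
lemma hasSum_binetIntegral {ω z a : ℂ} (hω : 0 < ω.re) (hz : 0 < (z * ω).re)
    (ha : (a * ω).re < (z * ω).re) :
    HasSum (fun k : ℕ => binetIntegral ω ((k + 1) * z - a))
      (∫ r in Ioi (0 : ℝ), exp (a * ω * r) / (exp (z * ω * r) - 1) * cothKernel (r * ω) * ω) := by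
  set C := 3 * ‖ω‖ ^ 2 / ω.re with hC
  have hpt : ∀ (k : ℕ) (r : ℝ), ((k + 1) * z - a) * ω * r =
      ((k + 1) * (z * ω) - a * ω) * r := fun k r => by ring
  simp only [binetIntegral, hpt]
  have hbs : ∀ r ∈ Ioi (0 : ℝ), HasSum
      (fun k : ℕ => C * ‖ω‖ * r * Real.exp (-(((k + 1) * (z * ω).re - (a * ω).re) * r)))
      (C * ‖ω‖ * (r * Real.exp ((a * ω).re * r) / (Real.exp ((z * ω).re * r) - 1))) := by
    intro r hr
    have h := hasSum_exp_neg_succ (E := 1) (a := ((a * ω).re : ℂ)) (c := ((z * ω).re : ℂ))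
      (by simpa using hz) hr
    simp only [mul_one] at h
    have h' : HasSum (fun k : ℕ => Real.exp (-(((k + 1) * (z * ω).re - (a * ω).re) * r)))
        (Real.exp ((a * ω).re * r) / (Real.exp ((z * ω).re * r) - 1)) :=
      hasSum_ofReal.1 (by push_cast; exact h)
    convert! h'.mul_left (C * ‖ω‖ * r) using 1
    ring
  refine hasSum_integral_of_dominated_convergence
    (fun k r => C * ‖ω‖ * r * Real.exp (-(((k + 1) * (z * ω).re - (a * ω).re) * r)))
    (fun k => ?_) (fun k => ?_) ?_ ?_ ?_
  · exact (((Continuous.continuousOn (by fun_prop)).mul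
      (continuousOn_cothKernel_ray hω)).mul continuousOn_const).aestronglyMeasurable
      measurableSet_Ioi
  · filter_upwards [ae_restrict_mem measurableSet_Ioi] with r hr
    rw [norm_mul, norm_mul, norm_exp_neg_mul_ofReal]
    have h1 : ((k + 1) * (z * ω) - a * ω).re = (k + 1) * (z * ω).re - (a * ω).re := by
      simp
    rw [h1]
    calc _ ≤ Real.exp (-(((k + 1) * (z * ω).re - (a * ω).re) * r)) * (C * r) * ‖ω‖ := by
          gcongr; exact norm_cothKernel_ray_le hω hr
      _ = _ := by ring
  · filter_upwards [ae_restrict_mem measurableSet_Ioi] with r hr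
    exact (hbs r hr).summable
  · refine ((integrableOn_mul_exp_div_exp_sub_one hz ha).const_mul (C * ‖ω‖)).congr ?_
    filter_upwards [ae_restrict_mem measurableSet_Ioi] with r hr
    exact (hbs r hr).tsum_eq.symm
  · filter_upwards [ae_restrict_mem measurableSet_Ioi] with r hr
    simpa only [mul_assoc] using
      hasSum_exp_neg_succ (E := cothKernel (r * ω) * ω) (a := a * ω) hz hr

/-! ### Values at `1`: the constants of Stirling and Euler -/

/-- The derivative of `r ↦ (e^{-ar} - e^{-br}) / r`. -/
def frullaniDeriv (a b : ℂ) (r : ℝ) : ℂ :=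
  (-a * exp (-(a * r)) + b * exp (-(b * r))) * (r : ℂ)⁻¹ +
    (exp (-(a * r)) - exp (-(b * r))) * -((r : ℂ) ^ 2)⁻¹

lemma hasDerivAt_cexp_neg_mul (a : ℂ) (r : ℝ) :
    HasDerivAt (fun r : ℝ => exp (-(a * r))) (-a * exp (-(a * r))) r := by
  have h : HasDerivAt (fun r : ℝ => -(a * (r : ℂ))) (-(a * 1)) r :=
    (((hasDerivAt_id r).ofReal_comp).const_mul a).neg
  convert! h.cexp using 1
  ring

lemma tendsto_cexp_neg_mul {a : ℂ} (ha : 0 < a.re) :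
    Tendsto (fun r : ℝ => exp (-(a * r))) atTop (𝓝 0) := by
  rw [tendsto_zero_iff_norm_tendsto_zero]
  simp_rw [norm_exp_neg_mul_ofReal]
  exact Real.tendsto_exp_neg_atTop_nhds_zero.comp (tendsto_id.const_mul_atTop ha)

/-- The boundary term is the limit `b - a` of `(e^{-ar} - e^{-br}) / r` at `0`, not its value `0`
there. -/
lemma integral_frullaniDeriv {a b : ℂ} (ha : 0 < a.re) (hb : 0 < b.re)
    (hint : IntegrableOn (frullaniDeriv a b) (Ioi 0)) :
    ∫ r in Ioi (0 : ℝ), frullaniDeriv a b r = a - b := by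
  have hu : ∀ r : ℝ, HasDerivAt (fun r : ℝ => exp (-(a * r)) - exp (-(b * r)))
      (-a * exp (-(a * r)) + b * exp (-(b * r))) r := fun r => by
    convert! (hasDerivAt_cexp_neg_mul a r).sub (hasDerivAt_cexp_neg_mul b r) using 1
    ring
  have hv : ∀ r ∈ Ioi (0 : ℝ), HasDerivAt (fun r : ℝ => (r : ℂ)⁻¹) (-((r : ℂ) ^ 2)⁻¹) r := by
    intro r hr
    have hr0 : (r : ℂ) ≠ 0 := by exact_mod_cast (ne_of_gt hr)
    convert! ((hasDerivAt_id r).ofReal_comp).inv hr0 using 1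
    simp [div_eq_mul_inv]
  have h := integral_Ioi_deriv_mul_eq_sub (a := 0) (a' := b - a) (b' := 0)
    (fun r _ => hu r) hv hint ?_ ?_
  · rw [zero_sub, neg_sub] at h
    exact h
  · have h1 := hasDerivAt_iff_tendsto_slope.1 (hu 0)
    simp only [ofReal_zero, mul_zero, neg_zero, exp_zero, mul_one] at h1
    have h2 : Tendsto (slope (fun r : ℝ => exp (-(a * r)) - exp (-(b * r))) 0) (𝓝[>] 0)
        (𝓝 (b - a)) := by
      rw [sub_eq_neg_add]
      exact h1.mono_left (nhdsWithin_mono _ fun r hr => ne_of_gt hr)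
    refine h2.congr fun r => ?_
    simp [slope, mul_comm]
  · have h1 := ((tendsto_cexp_neg_mul ha).sub (tendsto_cexp_neg_mul hb))
    have h2 : Tendsto (fun r : ℝ => (r : ℂ)⁻¹) atTop (𝓝 0) := by
      have := (continuous_ofReal.tendsto 0).comp tendsto_inv_atTop_zero
      simpa [Function.comp_def] using this
    have := h1.mul h2
    rw [sub_zero, zero_mul] at this
    exact this

/-- `∫ e^{-zu} (1 / (eᵘ - 1) - 1 / u + 1 / 2) du / u` along the ray `u = r ω`, `r > 0`: Binet's
integral for the remainder of `log Γ` in Stirling's formula. -/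
def binetLogIntegral (ω z : ℂ) : ℂ :=
  ∫ r in Ioi (0 : ℝ), exp (-(z * ω * r)) * (cothKernel (r * ω) / r)

lemma integrableOn_exp_mul_cothKernel_div {ω a : ℂ} (hω : 0 < ω.re) (ha : 0 < a.re) :
    IntegrableOn (fun r : ℝ => exp (-(a * r)) * (cothKernel (r * ω) / r)) (Ioi 0) := by
  refine ((integrableOn_exp_neg_mul ha).const_mul (3 * ‖ω‖ ^ 2 / ω.re)).mono' ?_ ?_
  · refine ((Continuous.continuousOn (by fun_prop)).mul
      ((continuousOn_cothKernel_ray hω).div (Continuous.continuousOn (by fun_prop))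
        fun r hr => ?_)).aestronglyMeasurable measurableSet_Ioi
    exact_mod_cast (ne_of_gt hr)
  · filter_upwards [ae_restrict_mem measurableSet_Ioi] with r hr
    have hr' : 0 < r := hr
    rw [norm_mul, norm_exp_neg_mul_ofReal, mul_comm, norm_div, norm_real,
      Real.norm_of_nonneg hr'.le]
    exact mul_le_mul_of_nonneg_right ((div_le_iff₀ hr').2 (norm_cothKernel_ray_le hω hr))
      (Real.exp_pos _).le

/-- The integrand of the difference is a multiple of Frullani's integrand up to an exact
derivative. -/
lemma binetLogIntegral_sub_add_one {ω z : ℂ} (hω : 0 < ω.re) (hz : 0 < (z * ω).re) :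
    binetLogIntegral ω z - binetLogIntegral ω (z + 1) =
      (z + 1 / 2) * (log (z + 1) - log z) - 1 := by
  have hz1 := re_add_one_mul_pos hω hz
  have hω0 := ne_zero_of_re_pos hω
  have hI1 := integrableOn_exp_mul_cothKernel_div hω hz
  have hI2 := integrableOn_exp_mul_cothKernel_div hω hz1
  have hI12 : IntegrableOn (fun r : ℝ => exp (-(z * ω * r)) * (cothKernel (r * ω) / r) -
      exp (-((z + 1) * ω * r)) * (cothKernel (r * ω) / r)) (Ioi 0) := hI1.sub hI2
  have hF := integrableOn_frullani hz hz1
  have hpt : ∀ r ∈ Ioi (0 : ℝ), frullaniDeriv (z * ω) ((z + 1) * ω) r =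
      ω * ((exp (-(z * ω * r)) * (cothKernel (r * ω) / r) -
        exp (-((z + 1) * ω * r)) * (cothKernel (r * ω) / r)) -
        (z + 1 / 2) * ((exp (-(z * ω * r)) - exp (-((z + 1) * ω * r))) / r)) := by
    intro r hr
    have hr0 : (r : ℂ) ≠ 0 := by exact_mod_cast (ne_of_gt hr)
    have hu : 0 < ((r : ℂ) * ω).re := by simpa using mul_pos hr hω
    have h2 : exp (-((z + 1) * ω * r)) = exp (-(z * ω * r)) * exp (-(r * ω)) := by
      rw [← exp_add]; ring_nf
    have h3 := cothKernel_mul_one_sub_exp hu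
    rw [frullaniDeriv, h2]
    trans ω * (exp (-(z * ω * r)) / r * ((1 - exp (-(r * ω))) * cothKernel (r * ω)) -
        (z + 1 / 2) * ((exp (-(z * ω * r)) - exp (-(z * ω * r)) * exp (-(r * ω))) / r))
    · rw [h3]; field_simp; ring
    · ring
  have hD : IntegrableOn (frullaniDeriv (z * ω) ((z + 1) * ω)) (Ioi 0) :=
    IntegrableOn.congr_fun ((hI12.sub (hF.const_mul (z + 1 / 2))).const_mul ω)
      (fun r hr => (hpt r hr).symm) measurableSet_Ioi
  have h := integral_frullaniDeriv hz hz1 hD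
  rw [setIntegral_congr_fun measurableSet_Ioi hpt, integral_const_mul,
    integral_sub hI12 (hF.const_mul _), integral_sub hI1 hI2, integral_const_mul,
    integral_frullani hz hz1, log_mul_of_re_pos hω hz, log_mul_of_re_pos hω hz1] at h
  change ω * (binetLogIntegral ω z - binetLogIntegral ω (z + 1) - _) = _ at h
  refine mul_left_cancel₀ hω0 ?_
  linear_combination h

lemma log_stirlingSeq_sub (n : ℕ) :
    Real.log (Stirling.stirlingSeq (n + 1)) - Real.log (Stirling.stirlingSeq (n + 2)) =
      ((n + 1 : ℝ) + 1 / 2) * (Real.log (n + 2) - Real.log (n + 1)) - 1 := by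
  rw [Stirling.log_stirlingSeq_formula, Stirling.log_stirlingSeq_formula,
    Nat.factorial_succ (n + 1)]
  push_cast
  rw [Real.log_mul (x := (n + 1 + 1 : ℝ)) (by positivity) (by positivity),
    Real.log_mul (x := 2) (by norm_num) (by positivity),
    Real.log_mul (x := 2) (by norm_num) (by positivity),
    Real.log_div (by positivity) (by positivity), Real.log_div (by positivity) (by positivity),
    Real.log_exp, show (n + 1 + 1 : ℝ) = n + 2 by ring]
  ring

lemma clog_natCast_add (n : ℕ) (m : ℕ) :
    log ((n : ℂ) + m) = (Real.log ((n : ℝ) + m) : ℝ) := by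
  rw [ofReal_log (by positivity)]; push_cast; rfl

/-- The value `1 - log (2π) / 2`, from Stirling's formula. -/
lemma binetLogIntegral_one {ω : ℂ} (hω : 0 < ω.re) :
    binetLogIntegral ω 1 = 1 - (Real.log (2 * Real.pi) : ℝ) / 2 := by
  have h1ω : 0 < ((1 : ℂ) * ω).re := by simpa
  have hsum : ∀ N : ℕ, ((Real.log (Stirling.stirlingSeq 1) -
      Real.log (Stirling.stirlingSeq (N + 1)) : ℝ) : ℂ) =
      binetLogIntegral ω 1 - binetLogIntegral ω (1 + N) := by
    intro N
    induction N with
    | zero => simp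
    | succ N ih =>
      have h := binetLogIntegral_sub_add_one hω (re_add_natCast_mul_pos hω h1ω N)
      have h2 := log_stirlingSeq_sub N
      have e1 : log ((1 : ℂ) + N) = (Real.log (N + 1) : ℝ) := by
        rw [add_comm]; exact_mod_cast clog_natCast_add N 1
      have e2 : log ((1 : ℂ) + N + 1) = (Real.log (N + 2) : ℝ) := by
        rw [show (1 : ℂ) + N + 1 = N + (2 : ℕ) by push_cast; ring]
        exact_mod_cast clog_natCast_add N 2
      rw [e1, e2] at h
      have h3 := congrArg (fun x : ℝ => (x : ℂ)) h2
      push_cast at h3 ih ⊢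
      rw [← add_assoc]
      rw [show ((N : ℕ) + 1 + 1) = N + 2 from rfl]
      linear_combination ih + h3 - h
  have hlim0 : Tendsto (fun N : ℕ => binetLogIntegral ω (1 + N)) atTop (𝓝 0) :=
    tendsto_integral_exp_add_natCast (z := 1) (F := fun r => cothKernel (r * ω) / r) hω
      (integrableOn_exp_mul_cothKernel_div hω h1ω)
  have hlim1 : Tendsto (fun N : ℕ => ((Real.log (Stirling.stirlingSeq 1) -
      Real.log (Stirling.stirlingSeq (N + 1)) : ℝ) : ℂ)) atTop (𝓝 (binetLogIntegral ω 1)) := by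
    simp_rw [hsum]
    simpa using tendsto_const_nhds.sub hlim0
  have hpi : 0 < √Real.pi := Real.sqrt_pos.2 Real.pi_pos
  have hlim2 : Tendsto (fun N : ℕ => ((Real.log (Stirling.stirlingSeq 1) -
      Real.log (Stirling.stirlingSeq (N + 1)) : ℝ) : ℂ)) atTop
      (𝓝 ((Real.log (Stirling.stirlingSeq 1) - Real.log √Real.pi : ℝ) : ℂ)) := by
    refine (continuous_ofReal.tendsto _).comp (tendsto_const_nhds.sub ?_)
    exact ((Real.continuousAt_log hpi.ne').tendsto.comp
      (Stirling.tendsto_stirlingSeq_sqrt_pi.comp (tendsto_add_atTop_nat 1)))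
  rw [tendsto_nhds_unique hlim1 hlim2, Stirling.stirlingSeq_one,
    Real.log_div (Real.exp_pos 1).ne' (by positivity), Real.log_exp, Real.log_sqrt (by norm_num),
    Real.log_sqrt Real.pi_pos.le, Real.log_mul (by norm_num) Real.pi_pos.ne']
  push_cast
  ring

/-- The value `γ - 1 / 2`, from the definition of Euler's constant. -/
lemma binetIntegral_one {ω : ℂ} (hω : 0 < ω.re) :
    binetIntegral ω 1 = Real.eulerMascheroniConstant - 1 / 2 := by
  have h1ω : 0 < ((1 : ℂ) * ω).re := by simpa
  refine tendsto_nhds_unique (tendsto_sum_binetStep hω h1ω) ?_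
  have hsum : ∀ N : ℕ, ∑ n ∈ Finset.range N, binetStep (1 + n) =
      ((harmonic N - Real.log (N + 1) : ℝ) : ℂ) + 1 / ((N : ℂ) + 1) / 2 - 1 / 2 := by
    intro N
    have e1 : log ((1 : ℂ) + N) = (Real.log (N + 1) : ℝ) := by
      rw [add_comm]; exact_mod_cast clog_natCast_add N 1
    rw [sum_binetStep, e1, log_one, sub_zero]
    have h2 : ∑ n ∈ Finset.range N, (1 / ((1 : ℂ) + n) + 1 / (1 + n + 1)) / 2 =
        (harmonic N : ℂ) + 1 / ((N : ℂ) + 1) / 2 - 1 / 2 := by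
      induction N with
      | zero => simp
      | succ N ih =>
        rw [Finset.sum_range_succ, ih, harmonic_succ]
        · push_cast
          rw [show (1 : ℂ) + N = N + 1 by ring]
          ring
        · rw [add_comm]; exact_mod_cast clog_natCast_add N 1
    rw [h2]
    push_cast
    ring
  simp_rw [hsum]
  have h3 : Tendsto (fun N : ℕ => 1 / ((N : ℂ) + 1)) atTop (𝓝 0) :=
    tendsto_one_div_add_atTop_nhds_zero_nat
  have h4 := (continuous_ofReal.tendsto _).comp Real.tendsto_harmonic_sub_log_add_one
  simpa [Function.comp_def] using (h4.add (h3.div_const 2)).sub_const (1 / 2)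

/-! ### Guinand's formula -/

/-- The antisymmetric combination of Bose factor and kernel that compares the two sides of
Guinand's formula. The products of two Bose factors cancel, and `1 / (eᵘ - 1)` is written as
`e^{-u} (cothKernel u + 1 / u + 1 / 2)` in what remains, which leaves integrals at `z = 1`. -/
lemma boseKernel_antisymm {ω x : ℂ} (hω : 0 < ω.re) (hx : 0 < (x * ω).re) {r : ℝ} (hr : 0 < r) :
    exp (0 * (x * ω) * r) / (exp (x⁻¹ * (x * ω) * r) - 1) * cothKernel (r * (x * ω)) * (x * ω) -
        x * (exp (0 * ω * r) / (exp (x * ω * r) - 1) * cothKernel (r * ω) * ω) =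
      x * (exp (-(1 * (x * ω) * r)) * (cothKernel (r * (x * ω)) / r)) -
        1 / 2 * (exp (-(1 * (x * ω) * r)) * cothKernel (r * (x * ω)) * (x * ω)) -
        exp (-(1 * ω * r)) * (cothKernel (r * ω) / r) +
        x / 2 * (exp (-(1 * ω * r)) * cothKernel (r * ω) * ω) -
        ω⁻¹ * frullaniDeriv (x * ω) ω r -
        (x + 1) / 2 * ((exp (-(x * ω * r)) - exp (-(ω * r))) / r) -
        (x * ω / 4 * exp (-(x * ω * r)) - x * ω / 4 * exp (-(ω * r))) := by
  have hω0 := ne_zero_of_re_pos hω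
  have hx0 : x ≠ 0 := left_ne_zero_of_mul (ne_zero_of_re_pos hx)
  have hr0 : (r : ℂ) ≠ 0 := by exact_mod_cast hr.ne'
  have hP : exp (ω * r) - 1 ≠ 0 := exp_sub_one_ne_zero (by simpa using mul_pos hω hr)
  have hQ : exp (x * ω * r) - 1 ≠ 0 := exp_sub_one_ne_zero (by
    rw [re_mul_ofReal]; exact mul_pos hx hr)
  have hP0 := exp_ne_zero (ω * r)
  have hQ0 := exp_ne_zero (x * ω * r)
  rw [inv_mul_cancel_left₀ hx0]
  simp only [cothKernel, frullaniDeriv, zero_mul, exp_zero, one_mul, exp_neg]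
  rw [mul_comm (r : ℂ) (x * ω), mul_comm (r : ℂ) ω]
  generalize exp (ω * r) = P at *
  generalize exp (x * ω * r) = Q at *
  field_simp
  ring

lemma hasSum_binetIntegral_zero {ω z : ℂ} (hω : 0 < ω.re) (hz : 0 < (z * ω).re) :
    HasSum (fun k : ℕ => binetIntegral ω ((k + 1) * z))
      (∫ r in Ioi (0 : ℝ), exp (0 * ω * r) / (exp (z * ω * r) - 1) * cothKernel (r * ω) * ω) := by
  simpa using hasSum_binetIntegral (a := 0) hω hz (by simpa using hz)

/-- Guinand's formula for `∑ (log (n x) - 1 / (2 n x) - ψ(n x))` and its value at `1 / x`. -/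
lemma guinand_formula {ω x : ℂ} (hω : 0 < ω.re) (hx : 0 < (x * ω).re) :
    ∑' k : ℕ, binetIntegral (x * ω) ((k + 1) * x⁻¹) - x * ∑' k : ℕ, binetIntegral ω ((k + 1) * x) =
      ((x - 1) * (Real.eulerMascheroniConstant - (Real.log (2 * Real.pi) : ℝ)) +
        (x + 1) * log x) / 2 := by
  have hω0 := ne_zero_of_re_pos hω
  have hx0 : x ≠ 0 := left_ne_zero_of_mul (ne_zero_of_re_pos hx)
  have hinv : x⁻¹ * (x * ω) = ω := inv_mul_cancel_left₀ hx0 ω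
  have hinv_re : 0 < (x⁻¹ * (x * ω)).re := by rwa [hinv]
  have h1ω : 0 < ((1 : ℂ) * ω).re := by simpa
  have h1x : 0 < ((1 : ℂ) * (x * ω)).re := by simpa using hx
  rw [(hasSum_binetIntegral_zero hx hinv_re).tsum_eq, (hasSum_binetIntegral_zero hω hx).tsum_eq,
    ← integral_const_mul]
  have hA : IntegrableOn (fun r : ℝ => exp (0 * (x * ω) * r) / (exp (x⁻¹ * (x * ω) * r) - 1) *
      cothKernel (r * (x * ω)) * (x * ω)) (Ioi 0) :=
    (integrableOn_boseKernel hx hinv_re (by simpa using hinv_re)).mul_const _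
  have hC : IntegrableOn (fun r : ℝ => x * (exp (0 * ω * r) / (exp (x * ω * r) - 1) *
      cothKernel (r * ω) * ω)) (Ioi 0) :=
    ((integrableOn_boseKernel hω hx (by simpa using hx)).mul_const _).const_mul _
  rw [← integral_sub hA hC]
  have h1 := (integrableOn_exp_mul_cothKernel_div hx h1x).const_mul x
  have h2 := (integrableOn_binet hx h1x).const_mul (1 / 2)
  have h3 := integrableOn_exp_mul_cothKernel_div hω h1ω
  have h4 := (integrableOn_binet hω h1ω).const_mul (x / 2)
  have h6 := (integrableOn_frullani hx hω).const_mul ((x + 1) / 2)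
  have h7 := (integrableOn_cexp_neg_mul hx).const_mul (x * ω / 4)
  have h8 := (integrableOn_cexp_neg_mul hω).const_mul (x * ω / 4)
  -- The other terms of `boseKernel_antisymm` are integrable, hence so is the exact derivative.
  have h5 : IntegrableOn (frullaniDeriv (x * ω) ω) (Ioi 0) := by
    refine IntegrableOn.congr_fun ((((((h1.sub h2).sub h3).add h4).sub h6).sub
      (h7.sub h8) |>.sub (hA.sub hC)).const_mul ω) (fun r hr => ?_) measurableSet_Ioi
    simp only [Pi.sub_apply, Pi.add_apply]
    rw [boseKernel_antisymm hω hx hr]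
    field_simp
    ring
  have h5' := h5.const_mul ω⁻¹
  have h12 := Integrable.sub' h1 h2
  have h123 := Integrable.sub' h12 h3
  have h1234 := Integrable.fun_add h123 h4
  have h12345 := Integrable.sub' h1234 h5'
  have h123456 := Integrable.sub' h12345 h6
  rw [setIntegral_congr_fun measurableSet_Ioi fun r hr => boseKernel_antisymm hω hx hr,
    integral_sub h123456 (Integrable.sub' h7 h8), integral_sub h12345 h6, integral_sub h1234 h5',
    integral_add h123 h4, integral_sub h12 h3, integral_sub h1 h2, integral_sub h7 h8]
  simp only [integral_const_mul]
  rw [integral_frullaniDeriv hx hω h5, integral_frullani hx hω, integral_cexp_neg_mul hx,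
    integral_cexp_neg_mul hω, log_mul_of_re_pos hω hx]
  change x * binetLogIntegral (x * ω) 1 - 1 / 2 * binetIntegral (x * ω) 1 -
    binetLogIntegral ω 1 + x / 2 * binetIntegral ω 1 - _ - _ - _ = _
  rw [binetLogIntegral_one hω, binetLogIntegral_one hx, binetIntegral_one hω, binetIntegral_one hx]
  field_simp
  ring

/-! ### The transformation of `L₁` in terms of Binet integrals -/

/-- Off the negative real axis a ray `ω` with `Re ω > 0` and `Re (x ω) > 0` exists: the bisector of
`1` and the conjugate of `x` will do. -/
lemma exists_ray {x : ℂ} (hx : x ∈ slitPlane) : ∃ ω : ℂ, 0 < ω.re ∧ 0 < (x * ω).re := by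
  have hx0 : 0 < ‖x‖ := norm_pos_iff.2 (slitPlane_ne_zero hx)
  have hre : 0 < x.re + ‖x‖ := by
    have h1 : -x.re ≤ ‖x‖ := (neg_le_abs _).trans (abs_re_le_norm x)
    rcases hx with h | h
    · linarith
    · rcases h1.lt_or_eq with h2 | h2
      · linarith
      · exfalso
        apply h
        have h3 := Complex.sq_norm x
        rw [normSq_apply, ← h2] at h3
        nlinarith
  refine ⟨starRingEnd ℂ x + ‖x‖, by simpa using hre, ?_⟩
  have h1 : x * (starRingEnd ℂ x + ‖x‖) = ‖x‖ * (x + ‖x‖) := by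
    rw [mul_add, mul_conj, normSq_eq_norm_sq]; push_cast; ring
  rw [h1, re_ofReal_mul]
  exact mul_pos hx0 (by simpa using hre)

lemma lambertTerm₁_self (σ : ℂ) (k : ℕ) :
    lambertTerm₁ σ σ k = exp (2 * Real.pi * I * σ) ^ (k + 1) /
      (1 - exp (2 * Real.pi * I * σ) ^ (k + 1)) := by
  rw [lambertTerm₁, pow_succ']

/-- The terms of `L₁` are differences of Binet integrals over two rays. -/
lemma two_pi_I_mul_lambertTerm₁ {σ ω ω' : ℂ} (hσ : 0 < σ.im) (hω : 0 < ω.re)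
    (hω' : 0 < ω'.re) (h : 0 < (-σ * ω).re) (h' : 0 < (σ * ω').re) (k : ℕ) :
    2 * Real.pi * I * lambertTerm₁ σ σ k =
      binetIntegral ω ((k + 1) * -σ) - binetIntegral ω' ((k + 1) * σ) := by
  have hk : (0 : ℝ) < k + 1 := by positivity
  have e : ∀ a b : ℂ, ((k + 1) * a * b).re = (k + 1) * (a * b).re := fun a b => by
    rw [mul_assoc, show ((k : ℂ) + 1) = ((k + 1 : ℝ) : ℂ) by push_cast; rfl, re_ofReal_mul]
  have h1 : 0 < ((k + 1) * -σ * ω).re := by rw [e]; exact mul_pos hk h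
  have h2 : 0 < (-((k + 1) * -σ) * ω').re := by
    rw [← mul_neg, neg_neg, e]; exact mul_pos hk h'
  have him : (((k : ℂ) + 1) * -σ).im < 0 := by
    rw [show ((k : ℂ) + 1) = ((k + 1 : ℝ) : ℂ) by push_cast; rfl, im_ofReal_mul, neg_im]
    nlinarith
  have hrefl := binetIntegral_neg_sub hω hω' h1 h2 him
  rw [← mul_neg, neg_neg] at hrefl
  rw [← neg_sub, hrefl, lambertTerm₁_self, ← exp_nat_mul]
  have hne : exp (2 * Real.pi * I * ((k + 1) * -σ)) - 1 ≠ 0 := by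
    apply exp_sub_one_ne_zero
    simp only [mul_re, mul_im, I_re, I_im, ofReal_re, ofReal_im, re_ofNat, im_ofNat]
    simp only [mul_zero, mul_one, zero_mul, sub_zero, add_zero, zero_sub]
    have := mul_pos Real.pi_pos (neg_pos.2 him)
    rw [mul_im] at this
    linarith
  have he : exp (2 * Real.pi * I * ((k + 1) * -σ)) =
      (exp (((k + 1 : ℕ) : ℂ) * (2 * Real.pi * I * σ)))⁻¹ := by
    rw [← exp_neg]; congr 1; push_cast; ring
  rw [he] at hne ⊢
  have hE := exp_ne_zero (((k + 1 : ℕ) : ℂ) * (2 * Real.pi * I * σ))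
  generalize exp (((k + 1 : ℕ) : ℂ) * (2 * Real.pi * I * σ)) = E at *
  have h3 : 1 - E ≠ 0 := by
    intro h
    apply hne
    rw [← sub_eq_zero.1 h]; simp
  rw [show (E⁻¹ - 1) = (1 - E) / E by field_simp]
  field_simp

lemma two_pi_I_mul_lambertL₁ {σ ω ω' : ℂ} (hσ : 0 < σ.im) (hω : 0 < ω.re)
    (hω' : 0 < ω'.re) (h : 0 < (-σ * ω).re) (h' : 0 < (σ * ω').re) :
    2 * Real.pi * I * lambertL₁ σ σ = ∑' k : ℕ, binetIntegral ω ((k + 1) * -σ) -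
      ∑' k : ℕ, binetIntegral ω' ((k + 1) * σ) := by
  rw [lambertL₁, ← tsum_mul_left,
    ← (hasSum_binetIntegral_zero hω h).summable.tsum_sub
      (hasSum_binetIntegral_zero hω' h').summable]
  exact tsum_congr fun k => two_pi_I_mul_lambertTerm₁ hσ hω hω' h h' k

lemma log_neg_of_im_pos {z : ℂ} (hz : 0 < z.im) : log (-z) = log z - Real.pi * I := by
  have := log_neg_of_im_neg (z := -z) (by simpa)
  rw [neg_neg] at this
  rw [this]; ring

lemma log_neg_two_pi_I_mul {z : ℂ} (hz : 0 < z.im) :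
    log (-2 * Real.pi * I * z) = (Real.log (2 * Real.pi) : ℝ) + log z - Real.pi / 2 * I := by
  have hz0 : z ≠ 0 := by rintro rfl; simp at hz
  have harg : 0 ≤ arg z := arg_nonneg_iff.2 hz.le
  have harg' : arg z ≤ Real.pi := arg_le_pi z
  have h1 : log (-I * z) = log (-I) + log z := by
    refine (log_mul_eq_add_log_iff (neg_ne_zero.2 I_ne_zero) hz0).2 ?_
    rw [arg_neg_I]
    constructor <;> linarith [Real.pi_pos]
  rw [show -2 * Real.pi * I * z = ((2 * Real.pi : ℝ) : ℂ) * (-I * z) by push_cast; ring,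
    log_ofReal_mul (by positivity) (mul_ne_zero (neg_ne_zero.2 I_ne_zero) hz0), h1, log_neg_I]
  ring

/-- The transformation of `L₁`, with the perturbation term as a sum of Binet integrals. -/
lemma lambertL₁_transform {τ ω : ℂ} (hτ : 0 < τ.im) (hω : 0 < ω.re) (h : 0 < (τ * ω).re) :
    2 * Real.pi * I * τ * lambertL₁ τ τ = 2 * Real.pi * I * lambertL₁ (-1 / τ) (-1 / τ) -
      2 * ∑' k : ℕ, binetIntegral (τ * ω) ((k + 1) * τ⁻¹) +
      log (-2 * Real.pi * I * τ) - Real.eulerMascheroniConstant + Real.pi * I * τ / 2 := by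
  have hτ0 : τ ≠ 0 := by rintro rfl; simp at hτ
  obtain ⟨ω', hω', h'⟩ := exists_ray (x := -τ) (Or.inr (by simpa using hτ.ne'))
  have h1 := guinand_formula hω h
  have h2 := guinand_formula hω' h'
  have h3 := two_pi_I_mul_lambertL₁ hτ hω' hω h' h
  have him : 0 < (-1 / τ).im := by
    rw [neg_div, one_div, neg_im, inv_im]
    have := normSq_pos.2 hτ0
    rw [neg_div, neg_neg]; positivity
  have h4 := two_pi_I_mul_lambertL₁ (σ := -1 / τ) (ω := τ * ω) (ω' := -τ * ω') him h h'
    (by rwa [show -(-1 / τ) * (τ * ω) = ω by field_simp])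
    (by rwa [show (-1 / τ) * (-τ * ω') = ω' by field_simp])
  rw [show -(-1 / τ) = τ⁻¹ by rw [neg_div, neg_neg, one_div],
    show -1 / τ = (-τ)⁻¹ by rw [neg_div, one_div, inv_neg]] at h4
  rw [show -1 / τ = (-τ)⁻¹ by rw [neg_div, one_div, inv_neg], h4, log_neg_two_pi_I_mul hτ]
  rw [log_neg_of_im_pos hτ] at h2
  -- With `A` and `B` the sums over `k / τ` and `-k / τ`, the right-hand side is now `-(A + B)` up to
  -- elementary terms. Guinand's formula at `τ` and `-τ` expresses `A + B` by the sums over `kτ` and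
  -- `-kτ`, that is, by `L₁(τ, τ)`.
  linear_combination τ * h3 + h1 + h2

/-! ### The perturbation term -/

/-- The integrand of `P` in the rotated variable `u = i t`, for which
`cot (t / 2) - 2 / t = 2 i cothKernel u`. -/
lemma perturbationIntegrand_ray (τ ν ε : ℂ) (hε : ε.im < 0) {r : ℝ} (hr : 0 < r) :
    perturbationIntegrand τ ν (r * ε) * ε =
      (exp (ν * τ⁻¹ * (I * ε) * r) - exp (-(ν * τ⁻¹ * (I * ε) * r))) / r *
        (1 / (exp (τ⁻¹ * (I * ε) * r) - 1) * cothKernel (r * (I * ε))) := by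
  have hε0 : ε ≠ 0 := by rintro rfl; simp at hε
  have hr0 : (r : ℂ) ≠ 0 := by exact_mod_cast hr.ne'
  have hu : 0 < ((r : ℂ) * (I * ε)).re := by
    simp; nlinarith
  have hcot : cot ((r * ε) / 2) - 2 / (r * ε) = 2 * I * cothKernel (r * (I * ε)) := by
    have hE := exp_sub_one_ne_zero hu
    rw [cot_eq_exp_ratio, cothKernel, show 2 * I * (r * ε / 2) = r * (I * ε) by ring]
    generalize exp (r * (I * ε)) = E at *
    have h1 : 1 - E ≠ 0 := by rw [← neg_sub]; exact neg_ne_zero.2 hE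
    have e1 : (E + 1) / (I * (1 - E)) = 2 * I * ((E - 1)⁻¹ + 1 / 2) := by
      rw [div_eq_iff (mul_ne_zero I_ne_zero h1)]
      field_simp
      linear_combination (E ^ 2 - 1) * I_sq
    have e2 : 2 / (r * ε) = 2 * I * (r * (I * ε))⁻¹ := by
      field_simp
    rw [e1, e2]; ring
  have hsin : sin (ν / τ * (r * ε)) = (exp (ν * τ⁻¹ * (I * ε) * r) -
      exp (-(ν * τ⁻¹ * (I * ε) * r))) / (2 * I) := by
    rw [sin, show -(ν / τ * (r * ε)) * I = -(ν * τ⁻¹ * (I * ε) * r) by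
      rw [div_eq_mul_inv]; ring, show ν / τ * (r * ε) * I = ν * τ⁻¹ * (I * ε) * r by
      rw [div_eq_mul_inv]; ring, eq_div_iff (mul_ne_zero two_ne_zero I_ne_zero)]
    linear_combination (exp (-(ν * τ⁻¹ * (I * ε) * r)) - exp (ν * τ⁻¹ * (I * ε) * r)) * I_sq
  rw [perturbationIntegrand, hcot, hsin, show I * (r * ε) / τ = τ⁻¹ * (I * ε) * r by
    rw [div_eq_mul_inv]; ring]
  field_simp

lemma exp_I_mul_im_neg {d : ℝ} (hd : d ∈ Ioo (-Real.pi) 0) : (exp (I * d)).im < 0 := by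
  rw [mul_comm, exp_ofReal_mul_I_im]
  exact Real.sin_neg_of_neg_of_neg_pi_lt hd.2 hd.1

lemma mem_admissibleDirections_iff {τ ν : ℂ} {d : ℝ} :
    d ∈ admissibleDirections τ ν ↔ d ∈ Ioo (-Real.pi) 0 ∧
      |(ν * τ⁻¹ * (I * exp (I * d))).re| < (τ⁻¹ * (I * exp (I * d))).re := by
  rw [admissibleDirections, mem_ofPred_eq,
    show exp (I * d) * ν * I / τ = ν * τ⁻¹ * (I * exp (I * d)) by rw [div_eq_mul_inv]; ring,
    show exp (I * d) * I / τ = τ⁻¹ * (I * exp (I * d)) by rw [div_eq_mul_inv]; ring]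

lemma I_mul_exp_re_pos {d : ℝ} (hd : d ∈ Ioo (-Real.pi) 0) : 0 < (I * exp (I * d)).re := by
  simpa using exp_I_mul_im_neg hd

/-- The integrand of `P`, written as an integral over `s` of exponentials
`exp (ν (1 - 2 s) u / τ)`, is absolutely integrable in both variables. -/
lemma integrable_prod_perturbation {ω a c : ℂ} (hω : 0 < ω.re) (ha : |a.re| < c.re) :
    Integrable (fun p : ℝ × ℝ => (a - -a) * exp (-((-a + p.2 * (a - -a)) * p.1)) *
        (1 / (exp (c * p.1) - 1) * cothKernel (p.1 * ω)))
      ((volume.restrict (Ioi 0)).prod (volume.restrict (Ioc 0 1))) := by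
  have hc : 0 < c.re := (abs_nonneg _).trans_lt ha
  set C := 3 * ‖ω‖ ^ 2 / ω.re with hC
  have hbd : Integrable (fun p : ℝ × ℝ => ‖a - -a‖ * (C *
      (p.1 * Real.exp (|a.re| * p.1) / (Real.exp (c.re * p.1) - 1))))
      ((volume.restrict (Ioi 0)).prod (volume.restrict (Ioc 0 1))) := by
    have h1 : Integrable (fun _ : ℝ => (1 : ℝ)) (volume.restrict (Ioc (0 : ℝ) 1)) := by simp
    simpa using ((((integrableOn_mul_exp_div_exp_sub_one hc ha).const_mul C).mul_prod
      h1).const_mul ‖a - -a‖)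
  refine hbd.mono' ?_ ?_
  · have h1 : AEStronglyMeasurable (fun r : ℝ => 1 / (exp (c * r) - 1) * cothKernel (r * ω))
        (volume.restrict (Ioi 0)) :=
      (continuousOn_boseKernel hω hc continuousOn_const).aestronglyMeasurable measurableSet_Ioi
    exact (Continuous.aestronglyMeasurable (by fun_prop)).mul h1.comp_fst
  · rw [Measure.prod_restrict]
    filter_upwards [ae_restrict_mem (measurableSet_Ioi.prod measurableSet_Ioc)] with p hp
    have hp1 : 0 < p.1 := hp.1
    have h1 := norm_boseKernel_le (a := 0) hω hc hp1
    simp only [zero_mul, exp_zero, zero_re, Real.exp_zero, mul_one] at h1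
    rw [norm_mul, norm_mul, norm_exp_neg_mul_ofReal]
    have h2 : -((-a + p.2 * (a - -a)).re * p.1) ≤ |a.re| * p.1 := by
      have h3 := re_segment_ge (a := -a) (b := a) (s := p.2) ⟨hp.2.1.le, hp.2.2⟩
      have h4 : -|a.re| ≤ min (-a).re a.re :=
        le_min (by rw [neg_re]; exact neg_le_neg (le_abs_self _)) (neg_abs_le _)
      nlinarith
    calc _ ≤ ‖a - -a‖ * Real.exp (|a.re| * p.1) * (C * (p.1 / (Real.exp (c.re * p.1) - 1))) := by
          gcongr
      _ = _ := by ring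

lemma integral_segment_perturbation (ω a c : ℂ) {r : ℝ} (hr : 0 < r) :
    ∫ s in Ioc (0 : ℝ) 1, (a - -a) * exp (-((-a + s * (a - -a)) * r)) *
        (1 / (exp (c * r) - 1) * cothKernel (r * ω)) =
      (exp (a * r) - exp (-(a * r))) / r *
        (1 / (exp (c * r) - 1) * cothKernel (r * ω)) := by
  rw [integral_mul_const, ← intervalIntegral.integral_of_le zero_le_one,
    integral_exp_segment _ _ hr.ne']
  simp

lemma integrableOn_perturbationIntegrand {τ ν : ℂ} {d : ℝ} (hd : d ∈ admissibleDirections τ ν) :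
    IntegrableOn (fun r : ℝ => perturbationIntegrand τ ν (r * exp (I * d)) * exp (I * d))
      (Ioi 0) := by
  rw [mem_admissibleDirections_iff] at hd
  refine (integrable_prod_perturbation (I_mul_exp_re_pos hd.1) hd.2).integral_prod_left.congr ?_
  filter_upwards [ae_restrict_mem measurableSet_Ioi] with r hr
  rw [integral_segment_perturbation _ _ _ hr,
    perturbationIntegrand_ray τ ν _ (exp_I_mul_im_neg hd.1) hr]

/-- `P` as an integral of sums of Binet integrals: `sinh (ν u / τ) / u` is an integral of
exponentials, and `1 / (exp (u / τ) - 1)` a geometric series. -/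
lemma rayP_eq_integral_tsum {τ ν : ℂ} {d : ℝ} (hd : d ∈ admissibleDirections τ ν) :
    rayP d τ ν = ∫ s in Ioc (0 : ℝ) 1, 2 * (ν * τ⁻¹) *
      ∑' k : ℕ, binetIntegral (I * exp (I * d)) ((k + 1) * τ⁻¹ - (1 - 2 * s) * (ν * τ⁻¹)) := by
  rw [mem_admissibleDirections_iff] at hd
  have hω := I_mul_exp_re_pos hd.1
  have hε := exp_I_mul_im_neg hd.1
  have hray := fun r (hr : r ∈ Ioi (0 : ℝ)) => perturbationIntegrand_ray τ ν _ hε hr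
  rw [rayP, setIntegral_congr_fun measurableSet_Ioi hray]
  generalize I * exp (I * d) = ω at *
  have hc : 0 < (τ⁻¹ * ω).re := (abs_nonneg _).trans_lt hd.2
  rw [setIntegral_congr_fun measurableSet_Ioi fun r hr =>
      (integral_segment_perturbation ω (ν * τ⁻¹ * ω) (τ⁻¹ * ω) hr).symm,
    integral_integral_swap (integrable_prod_perturbation hω hd.2)]
  refine setIntegral_congr_fun measurableSet_Ioc fun s hs => ?_
  have hs' : ((1 - 2 * s) * (ν * τ⁻¹) * ω).re < (τ⁻¹ * ω).re := by
    have e : ((1 - 2 * s) * (ν * τ⁻¹) * ω).re = (1 - 2 * s) * (ν * τ⁻¹ * ω).re := by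
      rw [mul_assoc, show (1 - 2 * s : ℂ) = ((1 - 2 * s : ℝ) : ℂ) by push_cast; rfl, re_ofReal_mul]
    rw [e]
    refine (le_abs_self _).trans_lt (lt_of_le_of_lt ?_ hd.2)
    rw [abs_mul]
    refine mul_le_of_le_one_left (abs_nonneg _) (abs_le.2 ⟨?_, ?_⟩) <;> linarith [hs.1, hs.2]
  rw [(hasSum_binetIntegral hω hc hs').tsum_eq, ← integral_const_mul]
  refine setIntegral_congr_fun measurableSet_Ioi fun r hr => ?_
  rw [show -((-(ν * τ⁻¹ * ω) + s * (ν * τ⁻¹ * ω - -(ν * τ⁻¹ * ω))) * r) =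
    (1 - 2 * s) * (ν * τ⁻¹) * ω * r by ring]
  ring

/-- The direction enters `rayP_eq_integral_tsum` only as the ray of Binet's integrals, which does
not matter. -/
lemma rayP_eq_rayP {τ ν : ℂ} {d d' : ℝ} (hd : d ∈ admissibleDirections τ ν)
    (hd' : d' ∈ admissibleDirections τ ν) : rayP d τ ν = rayP d' τ ν := by
  rw [rayP_eq_integral_tsum hd, rayP_eq_integral_tsum hd']
  rw [mem_admissibleDirections_iff] at hd hd'
  refine setIntegral_congr_fun measurableSet_Ioc fun s hs => ?_
  congr 1
  refine tsum_congr fun k => ?_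
  have key : ∀ ω : ℂ, |(ν * τ⁻¹ * ω).re| < (τ⁻¹ * ω).re →
      0 < (((k + 1) * τ⁻¹ - (1 - 2 * s) * (ν * τ⁻¹)) * ω).re := by
    intro ω h
    have e : (((k + 1) * τ⁻¹ - (1 - 2 * s) * (ν * τ⁻¹)) * ω) =
        ((k + 1 : ℝ) : ℂ) * (τ⁻¹ * ω) - ((1 - 2 * s : ℝ) : ℂ) * (ν * τ⁻¹ * ω) := by
      push_cast; ring
    rw [e, sub_re, re_ofReal_mul, re_ofReal_mul]
    have h1 : (1 - 2 * s) * (ν * τ⁻¹ * ω).re ≤ |(ν * τ⁻¹ * ω).re| := by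
      refine (le_abs_self _).trans ?_
      rw [abs_mul]
      refine mul_le_of_le_one_left (abs_nonneg _) (abs_le.2 ⟨?_, ?_⟩) <;> linarith [hs.1, hs.2]
    have h2 : 0 ≤ (k : ℝ) * (τ⁻¹ * ω).re :=
      mul_nonneg (Nat.cast_nonneg k) ((abs_nonneg _).trans h.le)
    linarith
  exact binetIntegral_eq_of_ray (I_mul_exp_re_pos hd.1) (key _ hd.2) (I_mul_exp_re_pos hd'.1)
    (key _ hd'.2)

lemma perturbationP_eq_rayP {τ ν : ℂ} {d : ℝ} (hd : d ∈ admissibleDirections τ ν) :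
    perturbationP τ ν = rayP d τ ν := by
  have h : (admissibleDirections τ ν).Nonempty := ⟨d, hd⟩
  rw [perturbationP, dif_pos h]
  exact rayP_eq_rayP h.some_mem hd

lemma exists_mem_admissibleDirections_zero {τ : ℂ} (hτ : 0 < τ.im) :
    (admissibleDirections τ 0).Nonempty := by
  obtain ⟨ω, hω, h⟩ := exists_ray (x := τ) (Or.inr hτ.ne')
  have hτ0 : τ ≠ 0 := by rintro rfl; simp at hτ
  have hne : -I * (τ * ω) ≠ 0 := mul_ne_zero (neg_ne_zero.2 I_ne_zero) (ne_zero_of_re_pos h)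
  have hn : 0 < ‖-I * (τ * ω)‖ := norm_pos_iff.2 hne
  have him : (-I * (τ * ω)).im < 0 := by
    rw [neg_mul, neg_im, I_mul_im]; linarith
  -- The direction `d` is chosen such that `i e^{id}` is a positive multiple of `τ ω`.
  have he : I * exp (I * (arg (-I * (τ * ω)))) = ((‖-I * (τ * ω)‖⁻¹ : ℝ) : ℂ) * (τ * ω) := by
    have := norm_mul_exp_arg_mul_I (-I * (τ * ω))
    have hn' : ((‖-I * (τ * ω)‖ : ℝ) : ℂ) ≠ 0 := by exact_mod_cast hn.ne'
    rw [mul_comm I (arg _ : ℂ), ofReal_inv, eq_inv_mul_iff_mul_eq₀ hn']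
    calc _ = I * (‖-I * (τ * ω)‖ * exp (arg (-I * (τ * ω)) * I)) := by ring
      _ = _ := by rw [this]; linear_combination -(τ * ω) * I_sq
  refine ⟨arg (-I * (τ * ω)), mem_admissibleDirections_iff.2 ⟨⟨neg_pi_lt_arg _,
    arg_neg_iff.2 him⟩, ?_⟩⟩
  rw [he, zero_mul, zero_mul, zero_re, abs_zero,
    show τ⁻¹ * (((‖-I * (τ * ω)‖⁻¹ : ℝ) : ℂ) * (τ * ω)) = ((‖-I * (τ * ω)‖⁻¹ : ℝ) : ℂ) * ω by
      field_simp, re_ofReal_mul]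
  positivity

/-- One direction computes `P` on a whole neighbourhood of `ν = 0`. -/
lemma eventually_mem_admissibleDirections {τ : ℂ} {d : ℝ} (hd : d ∈ admissibleDirections τ 0) :
    ∀ᶠ ν in 𝓝 (0 : ℂ), d ∈ admissibleDirections τ ν := by
  simp only [mem_admissibleDirections_iff] at hd ⊢
  have hcont : ContinuousAt (fun ν : ℂ => |(ν * τ⁻¹ * (I * exp (I * d))).re|) 0 := by fun_prop
  filter_upwards [hcont.eventually_lt continuousAt_const hd.2] with ν hν
  exact ⟨hd.1, hν⟩

/-- Differentiation under the integral sign turns `sinh (ν u / τ) / u` into `1 / τ`. -/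
lemma hasDerivAt_rayP {τ : ℂ} {d : ℝ} (hd : d ∈ admissibleDirections τ 0) :
    HasDerivAt (rayP d τ)
      (2 * τ⁻¹ * ∑' k : ℕ, binetIntegral (I * exp (I * d)) ((k + 1) * τ⁻¹)) 0 := by
  have hint := integrableOn_perturbationIntegrand hd
  rw [mem_admissibleDirections_iff] at hd
  have hω := I_mul_exp_re_pos hd.1
  have hε := exp_I_mul_im_neg hd.1
  have hray := fun ν r (hr : r ∈ Ioi (0 : ℝ)) => perturbationIntegrand_ray τ ν _ hε hr
  have hP : rayP d τ = fun ν => ∫ r in Ioi (0 : ℝ),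
      (exp (ν * τ⁻¹ * (I * exp (I * d)) * r) - exp (-(ν * τ⁻¹ * (I * exp (I * d)) * r))) / r *
        (1 / (exp (τ⁻¹ * (I * exp (I * d)) * r) - 1) * cothKernel (r * (I * exp (I * d)))) := by
    funext ν
    rw [rayP, setIntegral_congr_fun measurableSet_Ioi (hray ν)]
  have hint' := hint.congr_fun (hray 0) measurableSet_Ioi
  rw [hP]
  generalize I * exp (I * d) = ω at *
  have hc : 0 < (τ⁻¹ * ω).re := (abs_nonneg _).trans_lt hd.2
  rw [(hasSum_binetIntegral_zero hω hc).tsum_eq, ← integral_const_mul]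
  have hmeas : AEStronglyMeasurable (fun r : ℝ => 1 / (exp (τ⁻¹ * ω * r) - 1) *
      cothKernel (r * ω)) (volume.restrict (Ioi 0)) :=
    (continuousOn_boseKernel hω hc continuousOn_const).aestronglyMeasurable measurableSet_Ioi
  have hs : {ν : ℂ | ‖ν * τ⁻¹ * ω‖ < (τ⁻¹ * ω).re / 2} ∈ 𝓝 (0 : ℂ) := by
    have hcont : ContinuousAt (fun ν : ℂ => ‖ν * τ⁻¹ * ω‖) 0 := by fun_prop
    exact hcont.eventually_lt continuousAt_const (by simpa using hc)
  have h := (hasDerivAt_integral_of_dominated_loc_of_deriv_le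
    (μ := volume.restrict (Ioi (0 : ℝ))) (x₀ := (0 : ℂ)) (s := _)
    (F := fun ν r => (exp (ν * τ⁻¹ * ω * r) - exp (-(ν * τ⁻¹ * ω * r))) / r *
        (1 / (exp (τ⁻¹ * ω * r) - 1) * cothKernel (r * ω)))
    (F' := fun ν r => τ⁻¹ * ω * (exp (ν * τ⁻¹ * ω * r) + exp (-(ν * τ⁻¹ * ω * r))) *
        (1 / (exp (τ⁻¹ * ω * r) - 1) * cothKernel (r * ω)))
    (bound := fun r => 2 * ‖τ⁻¹ * ω‖ * (3 * ‖ω‖ ^ 2 / ω.re * (r * Real.exp ((τ⁻¹ * ω).re / 2 * r) /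
      (Real.exp ((τ⁻¹ * ω).re * r) - 1)))) hs ?_ hint' ?_ ?_ ?_ ?_).2
  · convert! h using 2
    ext r
    simp
    ring
  · refine Eventually.of_forall fun ν => AEStronglyMeasurable.mul ?_ hmeas
    exact Measurable.aestronglyMeasurable (by fun_prop)
  · exact AEStronglyMeasurable.mul (Continuous.aestronglyMeasurable (by fun_prop)) hmeas
  · filter_upwards [ae_restrict_mem measurableSet_Ioi] with r hr ν hν
    have hr' : 0 < r := hr
    have h1 := norm_boseKernel_le (a := 0) hω hc hr'
    simp only [zero_mul, exp_zero, zero_re, Real.exp_zero, mul_one] at h1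
    have h2 : ‖exp (ν * τ⁻¹ * ω * r)‖ ≤ Real.exp ((τ⁻¹ * ω).re / 2 * r) := by
      rw [norm_exp_mul_ofReal]
      gcongr
      exact (re_le_norm _).trans (le_of_lt hν)
    have h3 : ‖exp (-(ν * τ⁻¹ * ω * r))‖ ≤ Real.exp ((τ⁻¹ * ω).re / 2 * r) := by
      rw [norm_exp_neg_mul_ofReal, ← neg_mul]
      gcongr
      exact (neg_le_abs _).trans ((abs_re_le_norm _).trans (le_of_lt hν))
    rw [norm_mul, norm_mul]
    calc _ ≤ ‖τ⁻¹ * ω‖ * (Real.exp ((τ⁻¹ * ω).re / 2 * r) + Real.exp ((τ⁻¹ * ω).re / 2 * r)) *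
          (3 * ‖ω‖ ^ 2 / ω.re * (r / (Real.exp ((τ⁻¹ * ω).re * r) - 1))) := by
          gcongr
          exact (norm_add_le _ _).trans (add_le_add h2 h3)
      _ = _ := by ring
  · exact ((integrableOn_mul_exp_div_exp_sub_one hc (by linarith)).const_mul _).const_mul _
  · filter_upwards [ae_restrict_mem measurableSet_Ioi] with r hr ν _
    have hr0 : (r : ℂ) ≠ 0 := by exact_mod_cast (ne_of_gt hr)
    have e1 : HasDerivAt (fun ν : ℂ => ν * τ⁻¹ * ω * r) (τ⁻¹ * ω * r) ν := by
      simpa using (((hasDerivAt_id ν).mul_const τ⁻¹).mul_const ω).mul_const (r : ℂ)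
    have e2 : HasDerivAt (fun ν : ℂ => -(ν * τ⁻¹ * ω * r)) (-(τ⁻¹ * ω * r)) ν := e1.neg
    convert! ((e1.cexp.sub e2.cexp).div_const (r : ℂ)).mul_const
      (1 / (exp (τ⁻¹ * ω * r) - 1) * cothKernel (r * ω)) using 1
    field_simp
    ring

lemma hasDerivAt_perturbationP {τ : ℂ} {d : ℝ} (hd : d ∈ admissibleDirections τ 0) :
    HasDerivAt (fun ν : ℂ => perturbationP τ ν)
      (2 * τ⁻¹ * ∑' k : ℕ, binetIntegral (I * exp (I * d)) ((k + 1) * τ⁻¹)) 0 := by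
  refine (hasDerivAt_rayP hd).congr_of_eventuallyEq ?_
  filter_upwards [eventually_mem_admissibleDirections hd] with ν hν
  exact perturbationP_eq_rayP hν

/-! ### Convergence of the Lambert series, and the Eisenstein series `E₂` -/

lemma norm_exp_two_pi_I_mul_lt_one {σ : ℂ} (hσ : 0 < σ.im) :
    ‖exp (2 * Real.pi * I * σ)‖ < 1 := by
  simpa using UpperHalfPlane.norm_exp_two_pi_I_lt_one ⟨σ, hσ⟩

lemma summable_lambertTerm₂ {σ : ℂ} (hσ : 0 < σ.im) : Summable (lambertTerm₂ σ σ) := by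
  have h0 := summable_norm_pow_mul_geometric_div_one_sub 1 (norm_exp_two_pi_I_mul_lt_one hσ)
  have h := (summable_nat_add_iff (G := ℂ) 1).2 h0
  refine h.congr fun n => ?_
  rw [lambertTerm₂, lambertTerm₁_self]
  push_cast
  ring

lemma summable_lambertTerm₁ {σ : ℂ} (hσ : 0 < σ.im) : Summable (lambertTerm₁ σ σ) := by
  have h0 := summable_norm_pow_mul_geometric_div_one_sub 0 (norm_exp_two_pi_I_mul_lt_one hσ)
  have h := (summable_nat_add_iff (G := ℂ) 1).2 h0
  refine h.congr fun n => ?_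
  rw [lambertTerm₁_self, pow_zero, one_mul]

/-- Expanding the geometric series turns `L₂(τ, τ)` into `∑ σ₁(n) qⁿ`. -/
lemma E2_eq_one_sub_lambertL₂ (τ : UpperHalfPlane) :
    EisensteinSeries.E2 τ = 1 - 24 * lambertL₂ τ τ := by
  have h := tsum_pow_div_one_sub_eq_tsum_sigma (norm_exp_two_pi_I_mul_lt_one τ.im_pos) 1
  rw [EisensteinSeries.E2_eq_tsum_cexp]
  erw [← h]
  rw [tsum_pnat_eq_tsum_succ (f := fun n : ℕ => (n : ℂ) ^ 1 * exp (2 * Real.pi * I * τ) ^ n /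
    (1 - exp (2 * Real.pi * I * τ) ^ n)), lambertL₂]
  congr 2
  refine tsum_congr fun n => ?_
  rw [lambertTerm₂, lambertTerm₁_self]
  push_cast
  ring

lemma E2_S_smul (τ : UpperHalfPlane) :
    EisensteinSeries.E2 (ModularGroup.S • τ) =
      (τ : ℂ) ^ 2 * EisensteinSeries.E2 τ + 6 * τ / (Real.pi * I) := by
  have hτ : (τ : ℂ) ≠ 0 := τ.ne_zero
  have hpi : (Real.pi : ℂ) ≠ 0 := by exact_mod_cast Real.pi_ne_zero
  have h := EisensteinSeries.G2_S_transform τ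
  have hG : EisensteinSeries.G2 (ModularGroup.S • τ) =
      (τ : ℂ) ^ 2 * EisensteinSeries.G2 τ - 2 * Real.pi * I * τ := by
    rw [h]; field_simp; ring
  simp only [EisensteinSeries.E2, Pi.smul_apply, smul_eq_mul, hG, riemannZeta_two]
  field_simp
  ring_nf
  simp only [I_sq]
  ring

end

end LambertSeries

theorem theorem3p4 (τ : UpperHalfPlane) :
    -- the perturbation term does not depend on the admissible direction of integration
    (∀ (ν : ℂ) (d : ℝ), d ∈ admissibleDirections τ ν →
      MeasureTheory.IntegrableOn (fun r : ℝ =>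
        perturbationIntegrand τ ν (r * Complex.exp (Complex.I * d)) *
          Complex.exp (Complex.I * d)) (Set.Ioi 0) ∧
      perturbationP τ ν = rayP d τ ν) ∧
    DifferentiableAt ℂ (fun ν : ℂ => perturbationP τ ν) 0 ∧
    -- the two Lambert series converge absolutely
    Summable (lambertTerm₁ τ τ) ∧
    Summable (lambertTerm₂ τ τ) ∧
    -- the relation for `L₁`
    lambertL₁ τ τ =
      Complex.log (-2 * Real.pi * Complex.I * τ) / (2 * Real.pi * Complex.I * τ) + 1 / 4
        - Real.eulerMascheroniConstant / (2 * Real.pi * Complex.I * τ)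
        - 1 / (2 * Real.pi * Complex.I) * deriv (fun ν : ℂ => perturbationP τ ν) 0
        + lambertL₁ (-1 / τ) (-1 / τ) * (1 / τ) ∧
    -- the relation for `L₂`
    lambertL₂ τ τ =
      1 / 24 + 1 / (4 * Real.pi * Complex.I * τ) - 1 / (24 * (τ : ℂ) ^ 2)
        + lambertL₂ (-1 / τ) (-1 / τ) * (1 / (τ : ℂ) ^ 2) ∧
    -- its reading as the transformation law of the Eisenstein series `E₂`
    EisensteinSeries.E2 τ = 1 - 24 * lambertL₂ τ τ ∧
    EisensteinSeries.E2 (ModularGroup.S • τ) =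
      (τ : ℂ) ^ 2 * EisensteinSeries.E2 τ + 6 * τ / (Real.pi * Complex.I) := by
  have hτ := τ.im_pos
  have hτ0 : (τ : ℂ) ≠ 0 := τ.ne_zero
  have hpi : (Real.pi : ℂ) ≠ 0 := by exact_mod_cast Real.pi_ne_zero
  have hI := Complex.I_ne_zero
  obtain ⟨d, hd⟩ := LambertSeries.exists_mem_admissibleDirections_zero hτ
  have hderiv := LambertSeries.hasDerivAt_perturbationP hd
  have hE := LambertSeries.E2_eq_one_sub_lambertL₂ τ
  have hES := LambertSeries.E2_S_smul τ
  refine ⟨fun ν e he => ⟨LambertSeries.integrableOn_perturbationIntegrand he,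
    LambertSeries.perturbationP_eq_rayP he⟩, hderiv.differentiableAt,
    LambertSeries.summable_lambertTerm₁ hτ, LambertSeries.summable_lambertTerm₂ hτ,
    ?_, ?_, hE, hES⟩
  · rw [LambertSeries.mem_admissibleDirections_iff] at hd
    set ω := (τ : ℂ)⁻¹ * (Complex.I * Complex.exp (Complex.I * d)) with hω
    have hτω : (τ : ℂ) * ω = Complex.I * Complex.exp (Complex.I * d) := by
      rw [hω, mul_inv_cancel_left₀ hτ0]
    have h := LambertSeries.lambertL₁_transform (ω := ω) hτ ((abs_nonneg _).trans_lt hd.2)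
      (by rw [hτω]; exact LambertSeries.I_mul_exp_re_pos hd.1)
    rw [hτω] at h
    rw [hderiv.deriv]
    have h2 : (2 * Real.pi * Complex.I * τ : ℂ) ≠ 0 := by simp [hτ0, hpi]
    refine mul_left_cancel₀ h2 (h.trans ?_)
    field_simp
    ring
  · have hS := LambertSeries.E2_eq_one_sub_lambertL₂ (ModularGroup.S • τ)
    have hcoe : ((ModularGroup.S • τ : UpperHalfPlane) : ℂ) = -1 / τ := by
      rw [UpperHalfPlane.modular_S_smul]
      simp [neg_div, inv_neg]
    rw [hES, hE, hcoe] at hS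
    have hL : lambertL₂ (-1 / τ) (-1 / τ) = (1 - ((τ : ℂ) ^ 2 * (1 - 24 * lambertL₂ τ τ) +
        6 * τ / (Real.pi * Complex.I))) / 24 := by
      linear_combination hS / 24
    rw [hL]
    field_simp
    ring
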